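/- Let $d\in\mathbb N$, $\mathbb R^d_+=(0,\infty)^d$, and let $\mathcal S(\mathbb R^d_+)$ be the space of all complex-valued $f\in C^\infty(\mathbb R^d_+)$ such that every derivative $\partial^\alpha f$, $\alpha\in\mathbb N_0^d$, extends to a continuous function on $[0,\infty)^d$ and $\sup_{x\in\mathbb R^d_+}x^\beta|\partial^\alpha f(x)|<\infty$ for all $\alpha,\beta\in\mathbb N_0^d$. For $n\in\mathbb N_0^d$ let $$l_n(x)=\prod_{j=1}^d L_{n_j}(x_j)e^{-x_j/2},\qquad L_m(s)=\frac{e^s}{m!}\frac{d^m}{ds^m}\left(e^{-s}s^m\right),$$ be the Laguerre functions, and put $a_n(f)=\int_{\mathbb R^d_+}f(x)\,l_n(x)\,dx$ and $|n|=n_1+\dots+n_d$. The propagator of the Laguerre operator $E=-\sum_{j=1}^d\left(x_j\partial_{x_j}^2+\partial_{x_j}-\frac{x_j}{4}+\frac12\right)$, for which $E\,l_n=|n|\,l_n$, is defined by $$e^{zE}f=\sum_{n\in\mathbb N_0^d}e^{z|n|}a_n(f)\,l_n .$$ Let $I_0(\omega)=\sum_{m=0}^\infty \frac{(\omega/2)^{2m}}{(m!)^2}$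 be the modified Bessel function of order zero, and for $z\in\mathbb C$ with $e^z\neq1$ and $x,y\in\mathbb R^d_+$ put $$K_z(x,y)=(1-e^z)^{-d}\prod_{j=1}^d e^{-\frac12\cdot\frac{1+e^z}{1-e^z}(x_j+y_j)}\,I_0\!\left(\frac{2(x_jy_je^z)^{1/2}}{1-e^z}\right).$$ For $w\in\mathbb C$ with $|w|=1$, $w\neq1$, and $\mathbf w=(w,\dots,w)\in\mathbb C^d$, the fractional power of the Hankel--Clifford transform is $$\mathcal I_{\mathbf w,0}f(x)=(1-w)^{-d}\int_{\mathbb R^d_+}f(y)\prod_{j=1}^d e^{-\frac12\cdot\frac{1+w}{1-w}(x_j+y_j)}\,I_0\!\left(\frac{2\sqrt{x_jy_jw}}{1-w}\right)dy .$$ (As $I_0$ is even, the choice of the square roots is irrelevant.) Let $t\in\mathbb R\setminus 2\pi\mathbb Z$ and $f\in\mathcal S(\mathbb R^d_+)$. Then the series defining $e^{itE}f$ converges absolutely at every point of $\mathbb R^d_+$, and its sum belongs to $L^2(\mathbb R^d_+)$ and has the Laguerre coefficients $a_n(e^{itE}f)=e^{it|n|}a_n(f)$, $n\in\mathbb N_0^d$.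 Moreover, for every $x\in\mathbb R^d_+$ the function $y\mapsto f(y)K_{it}(x,y)$ is integrable on $\mathbb R^d_+$, and $$e^{itE}f(x)=\int_{\mathbb R^d_+}f(y)\,K_{it}(x,y)\,dy .$$ Consequently, with $\mathbf{e^{it}}=(e^{it},\dots,e^{it})$, $$e^{itE}f(x)=\mathcal I_{\mathbf{e^{it}},0}f(x),\qquad x\in\mathbb R^d_+ .$$ -/

import Mathlib

open scoped ContDiff

noncomputable section

/-- The open positive orthant `(0, ∞)^d`. -/
def orthant (d : ℕ) : Set (Fin d → ℝ) := {x | ∀ j, 0 < x j}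

/-- The partial derivative `∂f/∂x_j`. -/
def pderiv {d : ℕ} (j : Fin d) (f : (Fin d → ℝ) → ℂ) : (Fin d → ℝ) → ℂ :=
  fun x => fderiv ℝ f x (Pi.single j 1)

/-- The iterated partial derivative `∂_{v_1} ∂_{v_2} ⋯ ∂_{v_k} f` for a list `v` of coordinate
directions. For a smooth `f` the order of the list is irrelevant on the (open) orthant, so that
these are there exactly the derivatives `∂^α f`, where `α_j` is the number of occurrences
of `j` in `v`. -/
def iterPDeriv {d : ℕ} (v : List (Fin d)) (f : (Fin d → ℝ) → ℂ) : (Fin d → ℝ) → ℂ :=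
  v.foldr pderiv f

/-- `f` belongs to the Schwartz space `𝒮(ℝ^d_+)` of the orthant: `f` is smooth on the open
orthant, all its partial derivatives extend continuously to the closed orthant, and
`sup_x x^β |∂^α f(x)|` over the open orthant is finite for all multi-indices `α`, `β`.
Only the values of `f` on the open orthant matter. -/
structure IsSchwartzOnOrthant {d : ℕ} (f : (Fin d → ℝ) → ℂ) : Prop where
  smooth : ContDiffOn ℝ ∞ f (orthant d)
  extends_closure : ∀ v : List (Fin d), ∃ g : (Fin d → ℝ) → ℂ,
    ContinuousOn g (closure (orthant d)) ∧ Set.EqOn (iterPDeriv v f) g (orthant d)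
  decay : ∀ (v : List (Fin d)) (β : Fin d → ℕ), ∃ C : ℝ, ∀ x ∈ orthant d,
    (∏ j, x j ^ β j) * ‖iterPDeriv v f x‖ ≤ C

/-- The Laguerre polynomial `L_n(x) = (e^x / n!) (d/dx)^n (e^{-x} x^n)` (of order `0`). -/
def laguerrePoly (n : ℕ) (x : ℝ) : ℝ :=
  Real.exp x / (n.factorial : ℝ) * iteratedDeriv n (fun s : ℝ => Real.exp (-s) * s ^ n) x

/-- The `d`-dimensional Laguerre function `l_n(x) = ∏_j L_{n_j}(x_j) e^{-x_j/2}`. -/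
def laguerreFun {d : ℕ} (n : Fin d → ℕ) (x : Fin d → ℝ) : ℝ :=
  ∏ j, laguerrePoly (n j) (x j) * Real.exp (-(x j) / 2)

/-- The Laguerre coefficient `a_n(f) = ∫_{ℝ^d_+} f(x) l_n(x) dx`. -/
def laguerreCoeff {d : ℕ} (f : (Fin d → ℝ) → ℂ) (n : Fin d → ℕ) : ℂ :=
  ∫ x in orthant d, f x * (laguerreFun n x : ℂ)

/-- The `n`-th coefficient `e^{z|n|} a_n(f)` of the Laguerre series that defines `e^{zE} f`. -/
def propagatorCoeff {d : ℕ} (z : ℂ) (f : (Fin d → ℝ) → ℂ) (n : Fin d → ℕ) : ℂ :=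
  Complex.exp (z * ((∑ j, n j : ℕ) : ℂ)) * laguerreCoeff f n

/-- The propagator of the Laguerre operator, `e^{zE} f = ∑_n e^{z|n|} a_n(f) l_n`. -/
def laguerrePropagator {d : ℕ} (z : ℂ) (f : (Fin d → ℝ) → ℂ) (x : Fin d → ℝ) : ℂ :=
  ∑' n : Fin d → ℕ, propagatorCoeff z f n * (laguerreFun n x : ℂ)

/-- The modified Bessel function `I_0` of the first kind and order zero. The series converges
absolutely for every complex `w`. -/
def besselI0 (w : ℂ) : ℂ := ∑' n : ℕ, (w / 2) ^ (2 * n) / ((n.factorial : ℂ)) ^ 2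

/-- The kernel
`K_z(x,y) = (1-e^z)^{-d} ∏_j exp(-(1/2) (1+e^z)/(1-e^z) (x_j+y_j)) I_0(2 (x_j y_j e^z)^{1/2}/(1-e^z))`.
As `I_0` is even, the choice of the square root is irrelevant. -/
def propagatorKernel {d : ℕ} (z : ℂ) (x y : Fin d → ℝ) : ℂ :=
  ((1 - Complex.exp z) ^ d)⁻¹ *
    ∏ j, Complex.exp (-(1 / 2) * ((1 + Complex.exp z) / (1 - Complex.exp z)) * (x j + y j)) *
      besselI0 (2 * ((x j : ℂ) * (y j : ℂ) * Complex.exp z) ^ (1 / 2 : ℂ) / (1 - Complex.exp z))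

/-- The fractional power `ℐ_{𝐳,0} f` of the Hankel-Clifford transform, `𝐳 = (z, …, z)`. -/
def fracHankelClifford {d : ℕ} (z : ℂ) (f : (Fin d → ℝ) → ℂ) (x : Fin d → ℝ) : ℂ :=
  ((1 - z) ^ d)⁻¹ *
    ∫ y in orthant d, f y *
      ∏ j, Complex.exp (-(1 / 2) * ((1 + z) / (1 - z)) * (x j + y j)) *
        besselI0 (2 * ((x j : ℂ) * (y j : ℂ) * z) ^ (1 / 2 : ℂ) / (1 - z))

end

open scoped ContDiff

noncomputable section

/-! The formula is an Abel limit from inside the unit disc. For |w| < 1 the Hille–Hardy formula sums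
∑ wⁿ l_n(x) l_n(y) to `kernelOne w x y`. Taking products over the coordinates and integrating
termwise against f turns the Laguerre series with multiplier w^|n| into an integral operator
(`hasSum_pow_mul_laguerreCoeff`). Then w = r e^{it} and r ↑ 1 (`tsum_pow_mul_laguerreCoeff`).

On the integral side the limit is dominated because the kernel satisfies |K| ≤ |1 - w|^{-d} on the
whole closed disc without 1 (`norm_kernelOne_le`); integrability of f is then enough. On the series
side the coefficients must beat the growth of l_n. That growth is at most linear in each index, by
the same kernel bound on the diagonal (`abs_laguerreFunOne_le`). The coefficients decay rapidly
because 1 + E_j preserves the Schwartz class and multiplies a_n by n_j + 1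
(`laguerreCoeff_oneAddLaguerreOp`, `summable_laguerreCoeff`). Absolute summability of the
coefficients also places the sum in L² and, by orthonormality, identifies its coefficients.

Hille–Hardy itself comes from generating functions: L_n(x) is expanded in powers of x, the sum over
n is read off from the Taylor coefficients of the Laguerre generating function at w(1 + h), and the
sum over k is an exponential generating function producing I_0. -/

/-! ### Polynomials against decaying exponentials. -/

/-- A real polynomial is negligible against every growing exponential. -/
theorem polynomial_isLittleO_exp (q : Polynomial ℝ) {b : ℝ} (hb : 0 < b) :
    (fun s : ℝ => q.eval s) =o[Filter.atTop] fun s => Real.exp (b * s) := by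
  induction q using Polynomial.induction_on' with
  | add p q hp hq => simpa using hp.add hq
  | monomial n a => simpa using (isLittleO_pow_exp_pos_mul_atTop n hb).const_mul_left a

theorem polynomial_mul_exp_neg_integrableOn (q : Polynomial ℝ) {b : ℝ} (hb : 0 < b) :
    MeasureTheory.IntegrableOn (fun s : ℝ => q.eval s * Real.exp (-(b * s))) (Set.Ioi 0) := by
  refine integrable_of_isBigO_exp_neg (half_pos hb)
    (Continuous.continuousOn (by fun_prop)) ?_
  have h := ((polynomial_isLittleO_exp q (half_pos hb)).isBigO).mul
    (Asymptotics.isBigO_refl (fun s : ℝ => Real.exp (-(b * s))) Filter.atTop)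
  refine h.congr_right fun s => ?_
  rw [← Real.exp_add]
  congr 1
  ring

theorem polynomial_mul_exp_neg_tendsto (q : Polynomial ℝ) {b : ℝ} (hb : 0 < b) :
    Filter.Tendsto (fun s : ℝ => q.eval s * Real.exp (-(b * s))) Filter.atTop (nhds 0) := by
  refine ((polynomial_isLittleO_exp q hb).tendsto_div_nhds_zero).congr fun s => ?_
  rw [Real.exp_neg, div_eq_mul_inv]

theorem integral_pow_mul_exp_neg (k : ℕ) :
    ∫ s in Set.Ioi (0 : ℝ), s ^ k * Real.exp (-s) = k.factorial := by
  rw [← Real.Gamma_nat_eq_factorial, Real.Gamma_eq_integral (by positivity)]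
  refine MeasureTheory.setIntegral_congr_fun measurableSet_Ioi fun s _ => ?_
  simp [mul_comm]

/-! ### Laguerre polynomials and functions, and their differential equations. -/

/-- The Laguerre polynomial as a formal polynomial. -/
def laguerrePolynomial (n : ℕ) : Polynomial ℝ :=
  ∑ k ∈ Finset.range (n + 1),
    Polynomial.C ((-1) ^ k * (n.choose k : ℝ) / (k.factorial : ℝ)) * Polynomial.X ^ k

theorem laguerrePolynomial_coeff (n k : ℕ) :
    (laguerrePolynomial n).coeff k = (-1) ^ k * (n.choose k : ℝ) / (k.factorial : ℝ) := by
  simp only [laguerrePolynomial, Polynomial.finsetSum_coeff, Polynomial.coeff_C_mul_X_pow]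
  rw [Finset.sum_ite_eq]
  split_ifs with h
  · rfl
  · rw [Nat.choose_eq_zero_of_lt (by simpa using h)]
    simp

/-- Leibniz' rule in Rodrigues' formula; k counts the derivatives that fall on the exponential. -/
theorem laguerrePoly_eq_sum (n : ℕ) (x : ℝ) :
    laguerrePoly n x =
      ∑ k ∈ Finset.range (n + 1), (-1) ^ k * (n.choose k : ℝ) / (k.factorial : ℝ) * x ^ k := by
  unfold laguerrePoly
  rw [iteratedDeriv_fun_mul (by fun_prop) (by fun_prop), Finset.mul_sum]
  refine Finset.sum_congr rfl fun k hk => ?_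
  have hkn : k ≤ n := by simpa [Nat.lt_succ_iff] using hk
  rw [iteratedDeriv_comp_neg, iteratedDeriv_pow, iteratedDeriv_eq_iterate, Real.iter_deriv_exp,
    Nat.sub_sub_self hkn]
  have h1 : (k.factorial : ℝ) * (n.descFactorial (n - k) : ℝ) = n.factorial := by
    have := Nat.factorial_mul_descFactorial (Nat.sub_le n k)
    rw [Nat.sub_sub_self hkn] at this
    exact_mod_cast this
  have h2 : Real.exp x * Real.exp (-x) = 1 := by rw [← Real.exp_add]; simp
  have hk0 : (k.factorial : ℝ) ≠ 0 := by positivity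
  have hn0 : (n.factorial : ℝ) ≠ 0 := by positivity
  simp only [smul_eq_mul]
  field_simp
  calc _ = (Real.exp x * Real.exp (-x)) * (n.choose k : ℝ) * x ^ k *
      (k.factorial * n.descFactorial (n - k)) := by ring
    _ = _ := by rw [h1, h2]; ring

theorem laguerrePoly_eq_eval (n : ℕ) (x : ℝ) :
    laguerrePoly n x = (laguerrePolynomial n).eval x := by
  simp [laguerrePoly_eq_sum, laguerrePolynomial, Polynomial.eval_finsetSum]

/-- Laguerre's differential equation `x y'' + (1 - x) y' + n y = 0`. -/
theorem laguerrePolynomial_ode (n : ℕ) :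
    Polynomial.X * (laguerrePolynomial n).derivative.derivative +
      (1 - Polynomial.X) * (laguerrePolynomial n).derivative +
      Polynomial.C (n : ℝ) * laguerrePolynomial n = 0 := by
  ext k
  -- The coefficient of X^k in the equation is exactly this two-term recurrence.
  have key : ((k : ℝ) + 1) ^ 2 * (laguerrePolynomial n).coeff (k + 1) +
      (n - k) * (laguerrePolynomial n).coeff k = 0 := by
    rw [laguerrePolynomial_coeff, laguerrePolynomial_coeff]
    have h : (n.choose (k + 1) : ℝ) * (k + 1) = n.choose k * (n - k) := by
      rcases le_or_gt k n with h | h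
      · have := Nat.choose_succ_right_eq n k
        rw [← Nat.cast_sub h]
        exact_mod_cast this
      · rw [Nat.choose_eq_zero_of_lt h, Nat.choose_eq_zero_of_lt (by omega)]
        simp
    rw [Nat.factorial_succ]
    push_cast
    have hk0 : (k.factorial : ℝ) ≠ 0 := by positivity
    field_simp
    rw [pow_succ]
    linear_combination (-(-1) ^ k) * h
  rw [Polynomial.coeff_zero, ← key]
  cases k with
  | zero => simp [sub_mul, Polynomial.coeff_derivative]
  | succ k =>
    simp [sub_mul, Polynomial.coeff_derivative, Polynomial.coeff_X_mul]
    ring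

/-- The one-dimensional Laguerre function `L_n(s) e^{-s/2}`. -/
def laguerreFunOne (n : ℕ) (s : ℝ) : ℝ := laguerrePoly n s * Real.exp (-s / 2)

theorem laguerreFun_eq_prod {d : ℕ} (n : Fin d → ℕ) (x : Fin d → ℝ) :
    laguerreFun n x = ∏ j, laguerreFunOne (n j) (x j) := rfl

theorem laguerreFunOne_eq (n : ℕ) (s : ℝ) :
    laguerreFunOne n s = (laguerrePolynomial n).eval s * Real.exp (-(1 / 2 * s)) := by
  rw [laguerreFunOne, laguerrePoly_eq_eval]
  congr 2
  ring

theorem continuous_laguerreFunOne (n : ℕ) : Continuous (laguerreFunOne n) := by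
  rw [funext (laguerreFunOne_eq n)]
  fun_prop

/-- The derivative of the Laguerre function. -/
def laguerreFunOneDeriv (n : ℕ) (s : ℝ) : ℝ :=
  ((laguerrePolynomial n).derivative - Polynomial.C (1 / 2) * laguerrePolynomial n).eval s *
    Real.exp (-(1 / 2 * s))

theorem hasDerivAt_polynomial_mul_exp (q : Polynomial ℝ) (s : ℝ) :
    HasDerivAt (fun s => q.eval s * Real.exp (-(1 / 2 * s)))
      ((q.derivative - Polynomial.C (1 / 2) * q).eval s * Real.exp (-(1 / 2 * s))) s := by
  have h1 := q.hasDerivAt s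
  have h2 : HasDerivAt (fun s : ℝ => Real.exp (-(1 / 2 * s)))
      (Real.exp (-(1 / 2 * s)) * -(1 / 2 * 1)) s :=
    ((hasDerivAt_id s).const_mul (1 / 2 : ℝ)).neg.exp
  refine (h1.mul h2).congr_deriv ?_
  simp
  ring

theorem hasDerivAt_laguerreFunOne (n : ℕ) (s : ℝ) :
    HasDerivAt (laguerreFunOne n) (laguerreFunOneDeriv n s) s := by
  rw [funext (laguerreFunOne_eq n)]
  exact hasDerivAt_polynomial_mul_exp _ s

/-- The Laguerre functions are eigenfunctions: `(s l_n')' = (s/4 - 1/2 - n) l_n`. -/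
theorem hasDerivAt_mul_laguerreFunOneDeriv (n : ℕ) (s : ℝ) :
    HasDerivAt (fun s => s * laguerreFunOneDeriv n s)
      ((s / 4 - 1 / 2 - n) * laguerreFunOne n s) s := by
  have h := hasDerivAt_polynomial_mul_exp (Polynomial.X *
    ((laguerrePolynomial n).derivative - Polynomial.C (1 / 2) * laguerrePolynomial n)) s
  have h' : (fun s => s * laguerreFunOneDeriv n s) = fun s => (Polynomial.X *
    ((laguerrePolynomial n).derivative - Polynomial.C (1 / 2) * laguerrePolynomial n)).eval s *
      Real.exp (-(1 / 2 * s)) := by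
    ext s
    rw [laguerreFunOneDeriv, Polynomial.eval_mul, Polynomial.eval_X, mul_assoc]
  rw [h']
  refine h.congr_deriv ?_
  rw [laguerreFunOne_eq, ← mul_assoc (s / 4 - 1 / 2 - n : ℝ)]
  congr 1
  have ode := congrArg (Polynomial.eval s) (laguerrePolynomial_ode n)
  simp at ode ⊢
  linear_combination ode

/-! ### Orthonormality in one variable. -/

/-- Each difference lowers the lower index by one; after more than k of them nothing remains of a
polynomial of degree k. This vanishing is the source of orthogonality. -/
theorem fwdDiff_iter_choose_eq (m k y : ℕ) :
    (fwdDiff 1)^[m] (fun x ↦ (x.choose k : ℤ)) y = if m ≤ k then (y.choose (k - m) : ℤ) else 0 := by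
  rcases le_or_gt m k with h | h
  · obtain ⟨j, rfl⟩ := Nat.exists_eq_add_of_le h
    rw [fwdDiff_iter_choose]
    simp
  · obtain ⟨j, rfl⟩ := Nat.exists_eq_add_of_lt h
    have h0 := fwdDiff_iter_choose 0 k
    have h1 : fwdDiff 1 (fun x : ℕ ↦ (x.choose 0 : ℤ)) = fun _ => 0 := by
      ext; simp [fwdDiff]
    have h2 : ∀ i : ℕ, (fwdDiff 1)^[i] (fun _ : ℕ ↦ (0 : ℤ)) = fun _ => 0 := by
      intro i
      induction i with
      | zero => rfl
      | succ i ih => rw [Function.iterate_succ_apply']; rw [ih]; ext; simp [fwdDiff]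
    rw [show k + j + 1 = j + (1 + k) by ring, Function.iterate_add_apply,
      Function.iterate_add_apply]
    rw [add_zero] at h0
    rw [h0, Function.iterate_one, h1, h2, if_neg (by omega)]

theorem sum_neg_one_pow_choose_mul_choose (m k y : ℕ) :
    ∑ j ∈ Finset.range (m + 1), (-1 : ℝ) ^ j * (m.choose j : ℝ) * ((y + j).choose k : ℝ) =
      (-1) ^ m * if m ≤ k then (y.choose (k - m) : ℝ) else 0 := by
  have h := fwdDiff_iter_eq_sum_shift 1 (fun x ↦ (x.choose k : ℤ)) m y
  rw [fwdDiff_iter_choose_eq] at h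
  have h' := congrArg (fun z : ℤ => (-1 : ℝ) ^ m * (z : ℝ)) h
  push_cast at h'
  rw [h', Finset.mul_sum]
  refine Finset.sum_congr rfl fun j hj => ?_
  have hjm : j ≤ m := by simpa [Nat.lt_succ_iff] using hj
  have hs : (-1 : ℝ) ^ m * (-1) ^ (m - j) = (-1) ^ j := by
    obtain ⟨i, rfl⟩ := Nat.exists_eq_add_of_le hjm
    rw [Nat.add_sub_cancel_left, pow_add, mul_assoc, ← pow_add, ← two_mul]
    simp
  rw [← hs]
  simp
  ring

/-- The moments (k + j)! turn the integral into a double alternating binomial sum. The sum over j is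
an m-th difference of `choose · k` at k, which leaves C(k, m); the sum over k is then an n-th
difference of `choose · m` at 0, which is zero unless n = m. -/
theorem integral_laguerreFunOne_mul (n m : ℕ) :
    ∫ s in Set.Ioi (0 : ℝ), laguerreFunOne n s * laguerreFunOne m s =
      if n = m then 1 else 0 := by
  have hmon : ∀ k : ℕ, MeasureTheory.IntegrableOn (fun s : ℝ => s ^ k * Real.exp (-s))
      (Set.Ioi 0) := by
    intro k
    simpa using polynomial_mul_exp_neg_integrableOn (Polynomial.X ^ k) one_pos
  have hprod : ∀ s : ℝ, laguerreFunOne n s * laguerreFunOne m s =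
      ∑ k ∈ Finset.range (n + 1), ∑ j ∈ Finset.range (m + 1),
        ((-1) ^ k * (n.choose k : ℝ) / (k.factorial : ℝ) *
          ((-1) ^ j * (m.choose j : ℝ) / (j.factorial : ℝ))) *
          (s ^ (k + j) * Real.exp (-s)) := by
    intro s
    have he : Real.exp (-s / 2) * Real.exp (-s / 2) = Real.exp (-s) := by
      rw [← Real.exp_add]; congr 1; ring
    calc laguerreFunOne n s * laguerreFunOne m s
        = laguerrePoly n s * laguerrePoly m s * Real.exp (-s) := by
          rw [← he, laguerreFunOne, laguerreFunOne]; ring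
      _ = _ := by
          rw [laguerrePoly_eq_sum, laguerrePoly_eq_sum, Finset.sum_mul_sum, Finset.sum_mul]
          refine Finset.sum_congr rfl fun k _ => ?_
          rw [Finset.sum_mul]
          refine Finset.sum_congr rfl fun j _ => ?_
          rw [pow_add]; ring
  simp_rw [hprod]
  rw [MeasureTheory.integral_finsetSum _ fun k _ =>
    MeasureTheory.integrable_finsetSum _ fun j _ => (hmon _).const_mul _]
  have hinner : ∀ k ∈ Finset.range (n + 1),
      ∫ s in Set.Ioi (0 : ℝ), ∑ j ∈ Finset.range (m + 1),
        ((-1) ^ k * (n.choose k : ℝ) / (k.factorial : ℝ) *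
          ((-1) ^ j * (m.choose j : ℝ) / (j.factorial : ℝ))) *
          (s ^ (k + j) * Real.exp (-s)) =
      (-1) ^ m * ((-1) ^ k * (n.choose k : ℝ) * ((0 + k).choose m : ℝ)) := by
    intro k _
    rw [MeasureTheory.integral_finsetSum _ fun j _ => (hmon _).const_mul _]
    simp_rw [MeasureTheory.integral_const_mul, integral_pow_mul_exp_neg]
    have h := sum_neg_one_pow_choose_mul_choose m k k
    have h2 : (if m ≤ k then (k.choose (k - m) : ℝ) else 0) = k.choose m := by
      split_ifs with hmk
      · rw [Nat.choose_symm hmk]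
      · rw [Nat.choose_eq_zero_of_lt (by omega)]; simp
    rw [h2] at h
    rw [zero_add, show (-1 : ℝ) ^ m * ((-1) ^ k * (n.choose k : ℝ) * (k.choose m : ℝ)) =
      (-1) ^ k * (n.choose k : ℝ) * ((-1) ^ m * (k.choose m : ℝ)) by ring, ← h, Finset.mul_sum]
    refine Finset.sum_congr rfl fun j _ => ?_
    have hc : ((k + j).factorial : ℝ) = (k + j).choose k * k.factorial * j.factorial := by
      rw [← Nat.add_choose_mul_factorial_mul_factorial k j, Nat.choose_symm_add]; push_cast; ring
    rw [hc]
    have hk0 : (k.factorial : ℝ) ≠ 0 := by positivity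
    have hj0 : (j.factorial : ℝ) ≠ 0 := by positivity
    field_simp
  rw [Finset.sum_congr rfl hinner, ← Finset.mul_sum, sum_neg_one_pow_choose_mul_choose]
  rcases lt_trichotomy n m with h | rfl | h
  · rw [if_pos h.le, if_neg h.ne, Nat.choose_eq_zero_of_lt (by omega)]
    simp
  · rw [if_pos le_rfl, if_pos rfl, Nat.sub_self, Nat.choose_self, ← mul_assoc, ← pow_add,
      ← two_mul]
    simp
  · rw [if_neg (by omega), if_neg (by omega)]
    simp

/-! ### The generating function of the Laguerre polynomials. -/

/-- The Laguerre polynomial at a complex argument. -/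
def laguerreC (n : ℕ) (u : ℂ) : ℂ :=
  ∑ k ∈ Finset.range (n + 1), (n.choose k : ℂ) * ((-u) ^ k / (k.factorial : ℂ))

theorem laguerreC_ofReal (n : ℕ) (x : ℝ) : laguerreC n x = (laguerrePoly n x : ℂ) := by
  rw [laguerrePoly_eq_sum, laguerreC]
  push_cast
  refine Finset.sum_congr rfl fun k _ => ?_
  rw [neg_pow]
  ring

theorem one_sub_ne_zero_of_norm_lt_one {w : ℂ} (hw : ‖w‖ < 1) : 1 - w ≠ 0 := by
  intro h0
  rw [← sub_eq_zero.mp h0] at hw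
  simp at hw

theorem hasSum_choose_mul_pow {𝕜 : Type*} [RCLike 𝕜] (k : ℕ) {w : 𝕜} (hw : ‖w‖ < 1) :
    HasSum (fun n : ℕ => (n.choose k : 𝕜) * w ^ n) (w ^ k / (1 - w) ^ (k + 1)) := by
  have h := (hasSum_choose_mul_geometric_of_norm_lt_one k hw).mul_left (w ^ k)
  have h' : HasSum (fun n : ℕ => ((n + k).choose k : 𝕜) * w ^ (n + k))
      (w ^ k / (1 - w) ^ (k + 1)) := by
    convert! h using 1
    · ext n; rw [pow_add]; ring
    · ring
  rw [← hasSum_nat_add_iff' k, Finset.sum_eq_zero, sub_zero]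
  · exact h'
  · intro i hi
    rw [Nat.choose_eq_zero_of_lt (by simpa using hi)]
    simp

/-- The double series behind the generating function of the Laguerre polynomials. -/
theorem summable_laguerre_double {w : ℝ} (hw0 : 0 ≤ w) (hw : w < 1) {x : ℝ} (hx : 0 ≤ x) :
    Summable fun p : ℕ × ℕ => w ^ p.1 * ((p.1.choose p.2 : ℝ) * (x ^ p.2 / (p.2.factorial : ℝ))) := by
  -- With n as the inner index the sums have closed forms, and the outer sum over k is an
  -- exponential series.
  rw [← (Equiv.prodComm ℕ ℕ).summable_iff]
  have hn : ‖w‖ < 1 := by rwa [Real.norm_of_nonneg hw0]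
  have hk : ∀ k : ℕ, HasSum (fun n : ℕ => w ^ n * ((n.choose k : ℝ) * (x ^ k / (k.factorial : ℝ))))
      ((1 - w)⁻¹ * ((w * x / (1 - w)) ^ k / (k.factorial : ℝ))) := by
    intro k
    have h := (hasSum_choose_mul_pow (𝕜 := ℝ) k hn).mul_right (x ^ k / (k.factorial : ℝ))
    convert! h using 1
    · ext n; ring
    · have : 1 - w ≠ 0 := by linarith
      rw [div_pow, mul_pow]
      field_simp
      ring
  rw [summable_prod_of_nonneg fun p => by simp only [Function.comp, Pi.zero_apply]; positivity]
  refine ⟨fun k => (hk k).summable, ?_⟩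
  have : (fun k : ℕ => ∑' n : ℕ, ((fun p : ℕ × ℕ => w ^ p.1 * ((p.1.choose p.2 : ℝ) *
      (x ^ p.2 / (p.2.factorial : ℝ)))) ∘ (Equiv.prodComm ℕ ℕ)) (k, n)) =
      fun k : ℕ => (1 - w)⁻¹ * ((w * x / (1 - w)) ^ k / (k.factorial : ℝ)) :=
    funext fun k => (hk k).tsum_eq
  rw [this]
  exact (Real.summable_pow_div_factorial _).mul_left _

theorem hasSum_laguerreC_inner (n : ℕ) (u : ℂ) :
    HasSum (fun k : ℕ => (n.choose k : ℂ) * ((-u) ^ k / (k.factorial : ℂ))) (laguerreC n u) := by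
  refine hasSum_sum_of_ne_finset_zero fun k hk => ?_
  rw [Nat.choose_eq_zero_of_lt (by simpa using hk)]
  simp

theorem summable_laguerreC_double {w : ℂ} (hw : ‖w‖ < 1) (u : ℂ) :
    Summable fun p : ℕ × ℕ =>
      w ^ p.1 * ((p.1.choose p.2 : ℂ) * ((-u) ^ p.2 / (p.2.factorial : ℂ))) := by
  refine Summable.of_norm ?_
  refine (summable_laguerre_double (norm_nonneg w) hw (norm_nonneg u)).congr fun p => ?_
  simp

/-- Interchange of the order of summation in an absolutely convergent double series. -/
theorem hasSum_interchange {f : ℕ → ℕ → ℂ} (hs : Summable fun p : ℕ × ℕ => f p.1 p.2)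
    {g h : ℕ → ℂ} (hg : ∀ n, HasSum (fun k => f n k) (g n))
    (hh : ∀ k, HasSum (fun n => f n k) (h k)) {S : ℂ} (hS : HasSum h S) : HasSum g S := by
  have h1 : HasSum g (∑' p : ℕ × ℕ, f p.1 p.2) := hs.hasSum.prod_fiberwise hg
  have h2 : HasSum h (∑' p : ℕ × ℕ, f p.1 p.2) :=
    ((Equiv.prodComm ℕ ℕ).hasSum_iff.mpr hs.hasSum).prod_fiberwise hh
  rwa [← h2.unique hS]

/-- The generating function of the Laguerre polynomials. -/
theorem hasSum_laguerreC {w : ℂ} (hw : ‖w‖ < 1) (u : ℂ) :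
    HasSum (fun n : ℕ => w ^ n * laguerreC n u)
      ((1 - w)⁻¹ * Complex.exp (-(w * u / (1 - w)))) := by
  have hw1 := one_sub_ne_zero_of_norm_lt_one hw
  have h3 := (NormedSpace.expSeries_div_hasSum_exp (-(w * u / (1 - w)))).mul_left (1 - w)⁻¹
  rw [← Complex.exp_eq_exp_ℂ] at h3
  refine hasSum_interchange
    (f := fun n k => w ^ n * ((n.choose k : ℂ) * ((-u) ^ k / (k.factorial : ℂ))))
    (summable_laguerreC_double hw u) (fun n => (hasSum_laguerreC_inner n u).mul_left _)
    (fun k => ?_) h3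
  have h := (hasSum_choose_mul_pow k hw).mul_right ((-u) ^ k / (k.factorial : ℂ))
  convert! h using 1
  · ext n
    ring
  · rw [neg_pow (w * u / (1 - w)), neg_pow u, div_pow, mul_pow]
    field_simp
    ring

/-! ### The Hille–Hardy formula. -/

/-- The entire function `∑ q^m / (m!)²`, so that `I_0(u) = besselAux (u²/4)`. -/
def besselAux (q : ℂ) : ℂ := ∑' m : ℕ, q ^ m / (m.factorial : ℂ) ^ 2

theorem besselI0_eq (u : ℂ) : besselI0 u = besselAux (u ^ 2 / 4) := by
  unfold besselI0 besselAux
  congr 1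
  ext m
  rw [pow_mul]
  congr 2
  ring

theorem summable_besselAux_real (r : ℝ) (hr : 0 ≤ r) :
    Summable fun m : ℕ => r ^ m / (m.factorial : ℝ) ^ 2 := by
  refine (Real.summable_pow_div_factorial r).of_nonneg_of_le (fun m => by positivity) fun m => ?_
  have h1 : (1 : ℝ) ≤ m.factorial := by exact_mod_cast m.factorial_pos
  gcongr
  nlinarith

theorem summable_besselAux (q : ℂ) : Summable fun m : ℕ => ‖q ^ m / (m.factorial : ℂ) ^ 2‖ := by
  simpa using summable_besselAux_real ‖q‖ (norm_nonneg q)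

theorem continuous_besselAux : Continuous besselAux := by
  rw [continuous_iff_continuousAt]
  intro q
  have h : ContinuousOn besselAux (Metric.ball 0 (‖q‖ + 1)) := by
    refine continuousOn_tsum (fun m => by fun_prop)
      (summable_besselAux_real (‖q‖ + 1) (by positivity)) fun m z hz => ?_
    rw [norm_div, norm_pow, norm_pow, Complex.norm_natCast]
    have : ‖z‖ ≤ ‖q‖ + 1 := by simpa using (Metric.mem_ball.mp hz).le
    gcongr
  exact h.continuousAt (Metric.isOpen_ball.mem_nhds (by simp))

/-- The exponential generating function of the Laguerre polynomials. -/
theorem hasSum_laguerreC_div_factorial (s v : ℂ) :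
    HasSum (fun k : ℕ => s ^ k / (k.factorial : ℂ) * laguerreC k v)
      (Complex.exp s * besselAux (-(v * s))) := by
  have h1 : Summable fun k : ℕ => ‖s ^ k / (k.factorial : ℂ)‖ := by
    simpa using Real.summable_pow_div_factorial ‖s‖
  -- The claim is the Cauchy product of the `besselAux` series with the series of e^s.
  have h := hasSum_sum_range_mul_of_summable_norm (summable_besselAux (-(v * s))) h1
  have he : ∑' k : ℕ, s ^ k / (k.factorial : ℂ) = Complex.exp s := by
    rw [Complex.exp_eq_exp_ℂ]
    exact (NormedSpace.expSeries_div_hasSum_exp s).tsum_eq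
  rw [he, mul_comm _ (Complex.exp s)] at h
  convert! h using 1
  ext k
  rw [laguerreC, Finset.mul_sum]
  refine Finset.sum_congr rfl fun j hj => ?_
  have hjk : j ≤ k := by simpa [Nat.lt_succ_iff] using hj
  have hc : (k.factorial : ℂ) = k.choose j * j.factorial * (k - j).factorial := by
    exact_mod_cast (Nat.choose_mul_factorial_mul_factorial hjk).symm
  have hp : s ^ k = s ^ j * s ^ (k - j) := by rw [← pow_add, Nat.add_sub_cancel' hjk]
  have hch : (k.choose j : ℂ) ≠ 0 := by exact_mod_cast (Nat.choose_pos hjk).ne'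
  have hj0 : (j.factorial : ℂ) ≠ 0 := by exact_mod_cast j.factorial_ne_zero
  have hkj0 : ((k - j).factorial : ℂ) ≠ 0 := by exact_mod_cast (k - j).factorial_ne_zero
  rw [hc, hp, show -(v * s) = -v * s by ring, mul_pow]
  field_simp

theorem powerSeries_coeff_unique {a b : ℕ → ℂ} {F : ℂ → ℂ}
    (ha : ∀ᶠ h in nhds (0 : ℂ), HasSum (fun k : ℕ => h ^ k * a k) (F h))
    (hb : ∀ᶠ h in nhds (0 : ℂ), HasSum (fun k : ℕ => h ^ k * b k) (F h)) : a = b := by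
  have key : ∀ c : ℕ → ℂ, (∀ᶠ h in nhds (0 : ℂ), HasSum (fun k : ℕ => h ^ k * c k) (F h)) →
      HasFPowerSeriesAt F (FormalMultilinearSeries.ofScalars ℂ c) 0 := by
    intro c hc
    rw [hasFPowerSeriesAt_iff]
    simpa [FormalMultilinearSeries.coeff_ofScalars] using hc
  have h := (key a ha).eq_formalMultilinearSeries (key b hb)
  ext k
  have := congrArg (fun p => FormalMultilinearSeries.coeff p k) h
  simpa [FormalMultilinearSeries.coeff_ofScalars] using this

/-- Every `ρ < 1` gives the growth bound `|L_n(y)| ≤ C ρ⁻ⁿ`. -/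
theorem exists_laguerreC_bound (y : ℂ) {ρ : ℝ} (h0 : 0 < ρ) (h1 : ρ < 1) :
    ∃ C : ℝ, ∀ n, ρ ^ n * ‖laguerreC n y‖ ≤ C := by
  -- The terms of the convergent generating series at ρ are bounded.
  have hs := (hasSum_laguerreC (w := (ρ : ℂ)) (by simpa [abs_of_pos h0] using h1) y).summable
  obtain ⟨C, hC⟩ := hs.tendsto_atTop_zero.norm.bddAbove_range
  refine ⟨C, fun n => ?_⟩
  have := hC ⟨n, rfl⟩
  simpa [abs_of_pos h0] using this

/-- For `|w| < 1`, `|w^n L_n(y)|` decays geometrically. -/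
theorem exists_pow_mul_laguerreC_bound (y : ℂ) {w : ℂ} (hw : ‖w‖ < 1) :
    ∃ C q : ℝ, 0 ≤ C ∧ 0 ≤ q ∧ q < 1 ∧ ∀ n, ‖w ^ n * laguerreC n y‖ ≤ C * q ^ n := by
  obtain ⟨ρ, h1, h2⟩ := exists_between hw
  have hρ : 0 < ρ := (norm_nonneg w).trans_lt h1
  obtain ⟨C, hC⟩ := exists_laguerreC_bound y hρ h2
  refine ⟨C, ‖w‖ / ρ, le_trans (by positivity) (hC 0), by positivity,
    (div_lt_one hρ).mpr h1, fun n => ?_⟩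
  calc ‖w ^ n * laguerreC n y‖ = (‖w‖ / ρ) ^ n * (ρ ^ n * ‖laguerreC n y‖) := by
        rw [norm_mul, norm_pow, div_pow]
        field_simp
    _ ≤ (‖w‖ / ρ) ^ n * C := by gcongr; exact hC n
    _ = _ := mul_comm _ _

/-- `∑_n C(n,k) w^n L_n(y) = w^k (1-w)^{-k-1} e^{-wy/(1-w)} L_k(y/(1-w))`. -/
theorem hasSum_choose_mul_laguerreC {w : ℂ} (hw : ‖w‖ < 1) (y : ℂ) (k : ℕ) :
    HasSum (fun n : ℕ => (n.choose k : ℂ) * (w ^ n * laguerreC n y))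
      ((1 - w)⁻¹ * Complex.exp (-(w * y / (1 - w))) *
        ((w / (1 - w)) ^ k * laguerreC k (y / (1 - w)))) := by
  have hw1 := one_sub_ne_zero_of_norm_lt_one hw
  obtain ⟨C, q, hC0, hq0, hq1, hb⟩ := exists_pow_mul_laguerreC_bound y hw
  -- Since ∑ C(n,k)|h|^k = (1 + |h|)^n, the double series is dominated by a geometric series of
  -- ratio q(1 + |h|).
  have hsum : ∀ h : ℂ, q * (1 + ‖h‖) < 1 → Summable fun p : ℕ × ℕ =>
      h ^ p.2 * ((p.1.choose p.2 : ℂ) * (w ^ p.1 * laguerreC p.1 y)) := by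
    intro h hh
    have hfin : ∀ n : ℕ, HasSum (fun k : ℕ => C * q ^ n * (‖h‖ ^ k * (n.choose k : ℝ)))
        (C * (q * (1 + ‖h‖)) ^ n) := by
      intro n
      have : C * (q * (1 + ‖h‖)) ^ n = C * q ^ n * ∑ k ∈ Finset.range (n + 1),
          ‖h‖ ^ k * (n.choose k : ℝ) := by
        rw [mul_pow, add_comm 1, add_pow]
        simp
        ring
      rw [this]
      refine (hasSum_sum_of_ne_finset_zero fun k hk => ?_).mul_left _
      rw [Nat.choose_eq_zero_of_lt (by simpa using hk)]
      simp
    have hmaj : Summable fun p : ℕ × ℕ => C * q ^ p.1 * (‖h‖ ^ p.2 * (p.1.choose p.2 : ℝ)) := by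
      rw [summable_prod_of_nonneg fun p => by simp only [Pi.zero_apply]; positivity]
      refine ⟨fun n => (hfin n).summable, ?_⟩
      simp_rw [fun n => (hfin n).tsum_eq]
      exact (summable_geometric_of_lt_one (by positivity) hh).mul_left C
    refine Summable.of_norm_bounded hmaj fun p => ?_
    rw [norm_mul, norm_mul, norm_pow, Complex.norm_natCast]
    calc ‖h‖ ^ p.2 * ((p.1.choose p.2 : ℝ) * ‖w ^ p.1 * laguerreC p.1 y‖)
        ≤ ‖h‖ ^ p.2 * ((p.1.choose p.2 : ℝ) * (C * q ^ p.1)) := by gcongr; exact hb _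
      _ = _ := by ring
  have hev : ∀ᶠ h in nhds (0 : ℂ), q * (1 + ‖h‖) < 1 := by
    refine ContinuousAt.eventually_lt (by fun_prop) (by fun_prop) ?_
    simpa using hq1
  have hevw : ∀ᶠ h in nhds (0 : ℂ), ‖w * (1 + h)‖ < 1 := by
    refine ContinuousAt.eventually_lt (by fun_prop) (by fun_prop) ?_
    simpa using hw
  have hevs : ∀ᶠ h in nhds (0 : ℂ), ‖w * h / (1 - w)‖ < 1 := by
    refine ContinuousAt.eventually_lt (by fun_prop) (by fun_prop) ?_
    simp
  -- Each fixed-k series is a row of the double series at one admissible h ≠ 0, divided by h^k.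
  have hk : ∀ k, Summable fun n : ℕ => (n.choose k : ℂ) * (w ^ n * laguerreC n y) := by
    intro k
    obtain ⟨h, hh, hne⟩ := ((hev.filter_mono nhdsWithin_le_nhds).and
      (self_mem_nhdsWithin (a := (0 : ℂ)) (s := {0}ᶜ))).exists
    have := (((Equiv.prodComm ℕ ℕ).summable_iff.mpr (hsum h hh)).prod_factor k)
    have h2 := this.mul_left ((h ^ k)⁻¹)
    refine h2.congr fun n => ?_
    have hne' : h ^ k ≠ 0 := pow_ne_zero _ hne
    simp only [Function.comp, Equiv.prodComm_apply, Prod.swap]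
    rw [inv_mul_cancel_left₀ hne']
  -- The generating function at w(1 + h) is expanded in h twice: by the binomial theorem in each
  -- term, and through 1 - w(1 + h) = (1 - w)(1 - wh/(1 - w)), which makes it a multiple of the
  -- generating function at wh/(1 - w) with argument y/(1 - w).
  have heq := powerSeries_coeff_unique
    (a := fun k => ∑' n : ℕ, (n.choose k : ℂ) * (w ^ n * laguerreC n y))
    (b := fun k => (1 - w)⁻¹ * Complex.exp (-(w * y / (1 - w))) *
        ((w / (1 - w)) ^ k * laguerreC k (y / (1 - w))))
    (F := fun h => (1 - w * (1 + h))⁻¹ * Complex.exp (-(w * (1 + h) * y / (1 - w * (1 + h)))))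
    (by
      filter_upwards [hev, hevw] with h hh hh2
      have hS := hasSum_laguerreC hh2 y
      refine hasSum_interchange (f := fun k n => h ^ k * ((n.choose k : ℂ) * (w ^ n * laguerreC n y)))
        ((Equiv.prodComm ℕ ℕ).summable_iff.mpr (hsum h hh)) (fun k => (hk k).hasSum.mul_left _)
        (fun n => ?_) hS
      have : (w * (1 + h)) ^ n * laguerreC n y = ∑ k ∈ Finset.range (n + 1),
          h ^ k * ((n.choose k : ℂ) * (w ^ n * laguerreC n y)) := by
        rw [mul_pow, add_comm 1, add_pow, Finset.mul_sum, Finset.sum_mul]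
        refine Finset.sum_congr rfl fun k _ => ?_
        simp
        ring
      rw [this]
      refine hasSum_sum_of_ne_finset_zero fun k hk => ?_
      rw [Nat.choose_eq_zero_of_lt (by simpa using hk)]
      simp)
    (by
      filter_upwards [hevw, hevs] with h hh2 hh3
      have h1 := (hasSum_laguerreC hh3 (y / (1 - w))).mul_left
        ((1 - w)⁻¹ * Complex.exp (-(w * y / (1 - w))))
      have hd := one_sub_ne_zero_of_norm_lt_one hh2
      have hd2 := one_sub_ne_zero_of_norm_lt_one hh3
      have hd' : 1 - w * h / (1 - w) = (1 - w * (1 + h)) / (1 - w) := by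
        field_simp
        ring
      convert! h1 using 1
      · ext k; rw [div_pow, div_pow, mul_pow]; ring
      · rw [hd', show (1 - w)⁻¹ * Complex.exp (-(w * y / (1 - w))) *
          (((1 - w * (1 + h)) / (1 - w))⁻¹ * Complex.exp (-(w * h / (1 - w) * (y / (1 - w)) /
            ((1 - w * (1 + h)) / (1 - w))))) = ((1 - w)⁻¹ * ((1 - w * (1 + h)) / (1 - w))⁻¹) *
            (Complex.exp (-(w * y / (1 - w))) * Complex.exp (-(w * h / (1 - w) * (y / (1 - w)) /
            ((1 - w * (1 + h)) / (1 - w))))) by ring, ← Complex.exp_add]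
        congr 1
        · field_simp
        · congr 1
          field_simp
          ring)
  rw [← congrFun heq k]
  exact (hk k).hasSum

/-- The Hille-Hardy formula of order zero. -/
theorem hasSum_hilleHardy {w : ℂ} (hw : ‖w‖ < 1) (x y : ℂ) :
    HasSum (fun n : ℕ => w ^ n * laguerreC n x * laguerreC n y)
      ((1 - w)⁻¹ * Complex.exp (-(w * y / (1 - w))) * (Complex.exp (-(w * x / (1 - w))) *
        besselAux (x * y * w / (1 - w) ^ 2))) := by
  have hw1 := one_sub_ne_zero_of_norm_lt_one hw
  obtain ⟨C, q, hC0, hq0, hq1, hb⟩ := exists_pow_mul_laguerreC_bound y hw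
  have hs : Summable fun p : ℕ × ℕ => ((p.1.choose p.2 : ℂ) * ((-x) ^ p.2 / (p.2.factorial : ℂ))) *
      (w ^ p.1 * laguerreC p.1 y) := by
    refine Summable.of_norm_bounded
      ((summable_laguerre_double hq0 hq1 (norm_nonneg x)).mul_left C) fun p => ?_
    rw [norm_mul]
    calc _ ≤ ‖(p.1.choose p.2 : ℂ) * ((-x) ^ p.2 / (p.2.factorial : ℂ))‖ * (C * q ^ p.1) := by
          gcongr; exact hb _
      _ = _ := by simp; ring
  have h3 := (hasSum_laguerreC_div_factorial (-(w * x / (1 - w))) (y / (1 - w))).mul_left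
    ((1 - w)⁻¹ * Complex.exp (-(w * y / (1 - w))))
  -- Only L_n(x) is expanded. The sum over n at fixed k yields L_k(y/(1 - w)), and the sum over k is
  -- the exponential generating function `h3`.
  have h1 := hasSum_interchange (f := fun n k =>
    ((n.choose k : ℂ) * ((-x) ^ k / (k.factorial : ℂ))) * (w ^ n * laguerreC n y))
    (g := fun n => laguerreC n x * (w ^ n * laguerreC n y)) hs
    (fun n => (hasSum_laguerreC_inner n x).mul_right _) (fun k => by
      convert! (hasSum_choose_mul_laguerreC hw y k).mul_left ((-x) ^ k / (k.factorial : ℂ)) using 1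
      · ext n
        ring
      · rw [show -(w * x / (1 - w)) = -x * (w / (1 - w)) by ring, mul_pow]
        ring) h3
  convert! h1 using 1
  · ext n
    ring
  · congr 3
    field_simp

/-! ### Bessel's integral and the growth of I_0. -/

/-- Wallis' product in factorial form, so that (2m)! cancels against the cosh series. -/
theorem integral_sin_pow_even_eq (m : ℕ) :
    ∫ θ in (0 : ℝ)..Real.pi, Real.sin θ ^ (2 * m) =
      Real.pi * ((2 * m).factorial / (4 ^ m * (m.factorial : ℝ) ^ 2)) := by
  rw [integral_sin_pow_even]
  congr 1
  induction m with
  | zero => simp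
  | succ m ih =>
    rw [Finset.prod_range_succ, ih, show 2 * (m + 1) = 2 * m + 1 + 1 by ring,
      Nat.factorial_succ, Nat.factorial_succ, Nat.factorial_succ]
    have : (m.factorial : ℝ) ≠ 0 := by positivity
    push_cast
    field_simp
    ring

/-- Bessel's integral for `I_0`. -/
theorem integral_cosh_mul_sin (u : ℂ) :
    ∫ θ in (0 : ℝ)..Real.pi, Complex.cosh (u * Real.sin θ) = Real.pi * besselI0 u := by
  have h := intervalIntegral.hasSum_integral_of_dominated_convergence
    (μ := MeasureTheory.volume) (a := 0) (b := Real.pi)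
    (F := fun (m : ℕ) (θ : ℝ) => (u * Real.sin θ) ^ (2 * m) / ((2 * m).factorial : ℂ))
    (f := fun θ : ℝ => Complex.cosh (u * Real.sin θ))
    (fun m _ => ‖u‖ ^ (2 * m) / ((2 * m).factorial : ℝ))
    (fun m => (Continuous.aestronglyMeasurable (by fun_prop)))
    (fun m => Filter.Eventually.of_forall fun θ _ => by
      rw [norm_div, norm_pow, Complex.norm_natCast, norm_mul]
      have : ‖u‖ * ‖(Real.sin θ : ℂ)‖ ≤ ‖u‖ := by
        rw [Complex.norm_real]
        exact mul_le_of_le_one_right (norm_nonneg _) (Real.abs_sin_le_one θ)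
      gcongr)
    (Filter.Eventually.of_forall fun θ _ => (Real.hasSum_cosh ‖u‖).summable)
    (by simp)
    (Filter.Eventually.of_forall fun θ _ => Complex.hasSum_cosh _)
  have hs : HasSum (fun m : ℕ => (Real.pi : ℂ) * ((u / 2) ^ (2 * m) / ((m.factorial : ℂ)) ^ 2))
      (∫ θ in (0 : ℝ)..Real.pi, Complex.cosh (u * Real.sin θ)) := by
    convert! h using 1
    ext m
    have : ∀ θ : ℝ, (u * Real.sin θ) ^ (2 * m) / ((2 * m).factorial : ℂ) =
        u ^ (2 * m) / ((2 * m).factorial : ℂ) * ((Real.sin θ ^ (2 * m) : ℝ) : ℂ) := by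
      intro θ
      push_cast
      ring
    simp_rw [this]
    rw [intervalIntegral.integral_const_mul, intervalIntegral.integral_ofReal,
      integral_sin_pow_even_eq]
    have h1 : ((2 * m).factorial : ℂ) ≠ 0 := by exact_mod_cast (2 * m).factorial_ne_zero
    have h2 : (m.factorial : ℂ) ≠ 0 := by exact_mod_cast m.factorial_ne_zero
    push_cast
    rw [div_pow, pow_mul 2 2 m]
    norm_num
    field_simp
  rw [← hs.tsum_eq, tsum_mul_left]
  rfl

theorem norm_cosh_le (v : ℂ) : ‖Complex.cosh v‖ ≤ Real.exp |v.re| := by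
  rw [Complex.cosh, norm_div, Complex.norm_ofNat, div_le_iff₀ two_pos]
  refine (norm_add_le _ _).trans ?_
  rw [Complex.norm_exp, Complex.norm_exp, Complex.neg_re]
  have h1 := Real.exp_le_exp.mpr (le_abs_self v.re)
  have h2 := Real.exp_le_exp.mpr (neg_le_abs v.re)
  linarith

/-- Bessel's integral averages cosh(u sin θ), and |cosh v| ≤ e^{|Re v|}. The power series alone
would give e^{|u|}, which is too weak on |w| = 1, where the exponential factor of the kernel no
longer decays. -/
theorem norm_besselI0_le (u : ℂ) : ‖besselI0 u‖ ≤ Real.exp |u.re| := by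
  have h : ‖∫ θ in (0 : ℝ)..Real.pi, Complex.cosh (u * Real.sin θ)‖ ≤
      Real.exp |u.re| * |Real.pi - 0| := by
    refine intervalIntegral.norm_integral_le_of_norm_le_const fun θ _ => ?_
    refine (norm_cosh_le _).trans (Real.exp_le_exp.mpr ?_)
    rw [Complex.re_mul_ofReal, abs_mul]
    exact mul_le_of_le_one_right (abs_nonneg _) (Real.abs_sin_le_one θ)
  rw [integral_cosh_mul_sin, norm_mul, Complex.norm_real, sub_zero, mul_comm,
    Real.norm_eq_abs] at h
  exact le_of_mul_le_mul_right h (abs_pos.mpr Real.pi_ne_zero)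

/-! ### The one-dimensional kernel and its uniform bound. -/

/-- The one-dimensional propagator kernel, as a function of `w = e^z`. -/
def kernelOne (w : ℂ) (x y : ℝ) : ℂ :=
  (1 - w)⁻¹ * (Complex.exp (-(1 / 2) * ((1 + w) / (1 - w)) * (x + y)) *
    besselAux (x * y * w / (1 - w) ^ 2))

/-- Passing to `besselAux` leaves only the square of the complex root, so its branch disappears. -/
theorem propagatorKernel_eq {d : ℕ} (z : ℂ) (x y : Fin d → ℝ) :
    propagatorKernel z x y = ∏ j, kernelOne (Complex.exp z) (x j) (y j) := by
  unfold propagatorKernel kernelOne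
  rw [Finset.prod_mul_distrib (f := fun _ => (1 - Complex.exp z)⁻¹)]
  simp only [Finset.prod_const, Finset.card_univ, Fintype.card_fin, inv_pow]
  congr 1
  refine Finset.prod_congr rfl fun j _ => ?_
  rw [besselI0_eq, div_pow, mul_pow, ← Complex.cpow_nat_mul]
  norm_num
  congr 1
  ring

/-- Write w = v² and R = Re((1 + w)/(1 - w)) = (1 - |v|⁴)/|1 - v²|² ≥ 0. The Bessel argument is
√(xy) · 2v/(1 - v²), and 2|Re v| ≤ 1 + |v|² bounds the real part of 2v/(1 - v²) by R. As 2√(xy) ≤ x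
+ y, the decay e^{-R(x+y)/2} absorbs the growth e^{R√(xy)} of I_0. -/
theorem norm_kernelOne_le {w : ℂ} (hw : ‖w‖ ≤ 1) (hw1 : w ≠ 1) {x y : ℝ} (hx : 0 ≤ x)
    (hy : 0 ≤ y) : ‖kernelOne w x y‖ ≤ ‖1 - w‖⁻¹ := by
  obtain ⟨v, rfl⟩ : ∃ v : ℂ, w = v ^ 2 := ⟨w ^ (1 / 2 : ℂ), by
    rw [← Complex.cpow_nat_mul]; norm_num⟩
  have hv : v.re ^ 2 + v.im ^ 2 ≤ 1 := by
    rw [norm_pow, Complex.sq_norm, Complex.normSq_apply] at hw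
    nlinarith
  have hD : 0 < Complex.normSq (1 - v ^ 2) :=
    Complex.normSq_pos.mpr (sub_ne_zero.mpr (Ne.symm hw1))
  set R : ℝ := (1 - (v.re ^ 2 + v.im ^ 2) ^ 2) / Complex.normSq (1 - v ^ 2) with hR
  have hR0 : 0 ≤ R := div_nonneg (by nlinarith [sq_nonneg v.re, sq_nonneg v.im]) hD.le
  have h1 : ((1 + v ^ 2) / (1 - v ^ 2)).re = R := by
    rw [Complex.div_re, ← add_div, hR]
    congr 1
    simp [pow_two]
    ring
  have h2 : |(2 * v / (1 - v ^ 2)).re| ≤ R := by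
    have : (2 * v / (1 - v ^ 2)).re =
        2 * v.re * (1 - (v.re ^ 2 + v.im ^ 2)) / Complex.normSq (1 - v ^ 2) := by
      rw [Complex.div_re, ← add_div]
      congr 1
      simp [pow_two]
      ring
    rw [this, abs_div, abs_of_pos hD, hR]
    gcongr
    rw [abs_mul, abs_of_nonneg (by linarith : 0 ≤ 1 - (v.re ^ 2 + v.im ^ 2))]
    have h3 : |2 * v.re| ≤ 1 + (v.re ^ 2 + v.im ^ 2) := by
      rw [abs_le]
      constructor <;> nlinarith [sq_nonneg (v.re + 1), sq_nonneg (v.re - 1), sq_nonneg v.im]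
    calc _ ≤ (1 + (v.re ^ 2 + v.im ^ 2)) * (1 - (v.re ^ 2 + v.im ^ 2)) := by
          gcongr
      _ = _ := by ring
  set c : ℝ := Real.sqrt (x * y) with hc
  have hcc : c ^ 2 = x * y := Real.sq_sqrt (mul_nonneg hx hy)
  have hc2 : 2 * c ≤ x + y := by
    refine le_of_sq_le_sq ?_ (by positivity)
    nlinarith [sq_nonneg (x - y)]
  have hB : besselAux (x * y * v ^ 2 / (1 - v ^ 2) ^ 2) =
      besselI0 (c * (2 * v / (1 - v ^ 2))) := by
    rw [besselI0_eq]
    congr 1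
    have : (x : ℂ) * y = c ^ 2 := by rw [← Complex.ofReal_mul, ← hcc]; simp
    rw [this, mul_pow, div_pow, mul_pow]
    ring
  unfold kernelOne
  rw [norm_mul, norm_inv]
  refine mul_le_of_le_one_right (by positivity) ?_
  rw [norm_mul, hB, Complex.norm_exp]
  calc _ ≤ Real.exp (-(1 / 2) * R * (x + y)) * Real.exp (c * R) := by
        gcongr
        · rw [← h1, ← Complex.ofReal_add, Complex.re_mul_ofReal,
            show (-(1 / 2) : ℂ) = ((-(1 / 2) : ℝ) : ℂ) by push_cast; rfl, Complex.re_ofReal_mul]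
        · refine (norm_besselI0_le _).trans (Real.exp_le_exp.mpr ?_)
          rw [Complex.re_ofReal_mul, abs_mul, abs_of_nonneg (Real.sqrt_nonneg _)]
          gcongr
    _ ≤ 1 := by
        rw [← Real.exp_add, Real.exp_le_one_iff]
        nlinarith

theorem continuous_kernelOne (w : ℂ) (x : ℝ) : Continuous (kernelOne w x) := by
  unfold kernelOne
  refine continuous_const.mul (Continuous.mul (by fun_prop) (continuous_besselAux.comp ?_))
  fun_prop

/-- The kernel is continuous in `w` away from `w = 1`. -/
theorem continuousAt_kernelOne {w : ℂ} (hw : w ≠ 1) (x y : ℝ) :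
    ContinuousAt (fun w => kernelOne w x y) w := by
  have hw1 : 1 - w ≠ 0 := sub_ne_zero.mpr (Ne.symm hw)
  unfold kernelOne
  refine ContinuousAt.mul (by fun_prop (disch := assumption)) (ContinuousAt.mul ?_ ?_)
  · fun_prop (disch := assumption)
  · refine ContinuousAt.comp (g := besselAux) continuous_besselAux.continuousAt ?_
    have : (1 - w) ^ 2 ≠ 0 := pow_ne_zero 2 hw1
    fun_prop (disch := assumption)

/-! ### Mehler-type expansion and growth of the Laguerre functions. -/

/-- Mehler-type formula for the Laguerre functions. -/
theorem hasSum_laguerreFunOne {w : ℂ} (hw : ‖w‖ < 1) (x y : ℝ) :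
    HasSum (fun n : ℕ => w ^ n * (laguerreFunOne n x : ℂ) * (laguerreFunOne n y : ℂ))
      (kernelOne w x y) := by
  have hw1 := one_sub_ne_zero_of_norm_lt_one hw
  have h := (hasSum_hilleHardy hw x y).mul_left (Complex.exp (-(x + y) / 2))
  convert! h using 1
  · ext n
    rw [laguerreC_ofReal, laguerreC_ofReal, laguerreFunOne, laguerreFunOne,
      show (-((x : ℂ) + y) / 2) = -(x : ℂ) / 2 + -(y : ℂ) / 2 by ring, Complex.exp_add]
    push_cast
    ring
  -- The exponents combine by 1/2 + w/(1 - w) = (1 + w)/(2(1 - w)).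
  · rw [kernelOne, show ∀ a b c e f : ℂ, a * (b * c * (e * f)) = b * ((a * c * e) * f) by
      intros; ring, ← Complex.exp_add, ← Complex.exp_add]
    congr 3
    field_simp
    ring

/-- The Laguerre functions grow at most linearly in the index. -/
theorem abs_laguerreFunOne_le (n : ℕ) {x : ℝ} (hx : 0 ≤ x) :
    |laguerreFunOne n x| ≤ 3 * (n + 1) := by
  -- This r makes 1/(1 - r) = n + 2 while r^{-n} ≤ e. On the diagonal all terms of the expansion are
  -- nonnegative, so the n-th is at most the kernel, hence at most n + 2.
  set r : ℝ := (n + 1) / (n + 2) with hr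
  have hr0 : 0 < r := by positivity
  have hr1 : r < 1 := by
    rw [hr, div_lt_one (by positivity)]
    linarith
  have h1r : 1 - r = 1 / (n + 2) := by
    rw [hr]
    field_simp
    ring
  have hn : ‖(r : ℂ)‖ = r := by simp [abs_of_pos hr0]
  have h := hasSum_laguerreFunOne (w := (r : ℂ)) (by rw [hn]; exact hr1) x x
  have hb := norm_kernelOne_le (w := (r : ℂ)) (by rw [hn]; exact hr1.le)
    (by exact_mod_cast hr1.ne) hx hx
  have h' : HasSum (fun n : ℕ => r ^ n * laguerreFunOne n x ^ 2) (kernelOne r x x).re := by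
    convert! Complex.hasSum_re h using 1
    ext n
    rw [← Complex.ofReal_pow, ← Complex.ofReal_mul, ← Complex.ofReal_mul, Complex.ofReal_re]
    ring
  have hle : r ^ n * laguerreFunOne n x ^ 2 ≤ n + 2 := by
    refine (le_hasSum h' n fun m _ => by positivity).trans ((Complex.re_le_norm _).trans
      (hb.trans (le_of_eq ?_)))
    rw [← Complex.ofReal_one, ← Complex.ofReal_sub, Complex.norm_real, h1r, Real.norm_of_nonneg
      (by positivity)]
    simp
  have hrn : (r⁻¹) ^ n ≤ 3 := by
    have h1 : r⁻¹ = 1 / (n + 1) + 1 := by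
      rw [hr]
      field_simp
      ring
    calc (r⁻¹) ^ n ≤ (Real.exp (1 / (n + 1))) ^ n := by
          rw [h1]
          gcongr
          exact Real.add_one_le_exp _
      _ = Real.exp (n * (1 / (n + 1))) := by rw [← Real.exp_nat_mul]
      _ ≤ Real.exp 1 := by
          gcongr
          rw [mul_one_div, div_le_one (by positivity)]
          linarith
      _ ≤ 3 := Real.exp_one_lt_three.le
  refine abs_le_of_sq_le_sq ?_ (by positivity)
  calc laguerreFunOne n x ^ 2 = (r⁻¹) ^ n * (r ^ n * laguerreFunOne n x ^ 2) := by
        rw [inv_pow]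
        field_simp
    _ ≤ 3 * ((n : ℝ) + 2) := by gcongr
    _ ≤ (3 * ((n : ℝ) + 1)) ^ 2 := by nlinarith [(Nat.cast_nonneg n : (0 : ℝ) ≤ n)]

/-! ### Products over coordinates and the orthant. -/

/-- Induction splitting off the first coordinate; norm summability is carried along because
multiplying two series requires it. -/
theorem hasSum_fin_prod {𝕜 : Type*} [NormedField 𝕜] [CompleteSpace 𝕜] {d : ℕ} {f : Fin d → ℕ → 𝕜} {S : Fin d → 𝕜}
    (hf : ∀ j, Summable fun n => ‖f j n‖) (hS : ∀ j, HasSum (f j) (S j)) :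
    HasSum (fun n : Fin d → ℕ => ∏ j, f j (n j)) (∏ j, S j) ∧
      Summable fun n : Fin d → ℕ => ‖∏ j, f j (n j)‖ := by
  induction d with
  | zero => exact ⟨by simp, .of_finite⟩
  | succ d ih =>
    obtain ⟨h1, h2⟩ := ih (fun j => hf j.succ) (fun j => hS j.succ)
    let e : ℕ × (Fin d → ℕ) ≃ (Fin (d + 1) → ℕ) := Fin.consEquiv fun _ => ℕ
    have he : ∀ p, ∏ j, f j (e p j) = f 0 p.1 * ∏ j : Fin d, f j.succ (p.2 j) := fun p => by
      rw [Fin.prod_univ_succ]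
      rfl
    have hs := summable_mul_of_summable_norm (f := f 0)
      (g := fun m : Fin d → ℕ => ∏ j : Fin d, f j.succ (m j)) (hf 0) h2
    have hm := HasSum.mul (f := f 0) (g := fun m : Fin d → ℕ => ∏ j : Fin d, f j.succ (m j))
      (hS 0) h1 hs
    have hn := Summable.mul_norm (f := f 0)
      (g := fun m : Fin d → ℕ => ∏ j : Fin d, f j.succ (m j)) (hf 0) h2
    constructor
    · rw [← e.hasSum_iff, Fin.prod_univ_succ]
      convert! hm using 1
      exact funext he
    · rw [← e.summable_iff]
      convert! hn using 1
      exact funext fun p => congrArg _ (he p)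

theorem summable_prod_inv_sq (d : ℕ) :
    Summable fun n : Fin d → ℕ => ∏ j, (((n j : ℝ) + 1) ^ 2)⁻¹ := by
  have h : Summable fun n : ℕ => (((n : ℝ) + 1) ^ 2)⁻¹ := by
    have := (summable_nat_add_iff 1).mpr (Real.summable_nat_pow_inv.mpr (by norm_num : 1 < 2))
    simpa using this
  exact (hasSum_fin_prod (f := fun (_ : Fin d) n => (((n : ℝ) + 1) ^ 2)⁻¹)
    (fun _ => h.norm) (fun _ => h.hasSum)).1.summable

theorem orthant_eq_pi (d : ℕ) : orthant d = Set.pi Set.univ fun _ => Set.Ioi 0 := by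
  ext x
  simp [orthant]

theorem measurableSet_orthant (d : ℕ) : MeasurableSet (orthant d) := by
  rw [orthant_eq_pi]
  exact MeasurableSet.univ_pi fun _ => measurableSet_Ioi

theorem isOpen_orthant (d : ℕ) : IsOpen (orthant d) := by
  rw [orthant_eq_pi]
  exact isOpen_set_pi Set.finite_univ fun _ _ => isOpen_Ioi

theorem volume_restrict_orthant (d : ℕ) :
    (MeasureTheory.volume.restrict (orthant d) : MeasureTheory.Measure (Fin d → ℝ)) =
      MeasureTheory.Measure.pi fun _ => MeasureTheory.volume.restrict (Set.Ioi (0 : ℝ)) := by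
  rw [orthant_eq_pi, MeasureTheory.volume_pi, MeasureTheory.Measure.restrict_pi_pi]

theorem continuous_laguerreFun {d : ℕ} (n : Fin d → ℕ) : Continuous (laguerreFun n) := by
  rw [funext (laguerreFun_eq_prod n)]
  exact continuous_finsetProd _ fun j _ => (continuous_laguerreFunOne (n j)).comp
    (continuous_apply j)

theorem integrableOn_laguerreFunOne_mul (n m : ℕ) :
    MeasureTheory.IntegrableOn (fun s => laguerreFunOne n s * laguerreFunOne m s)
      (Set.Ioi 0) := by
  refine (polynomial_mul_exp_neg_integrableOn (laguerrePolynomial n * laguerrePolynomial m)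
    one_pos).congr_fun (fun s _ => ?_) measurableSet_Ioi
  simp only []
  rw [laguerreFunOne_eq, laguerreFunOne_eq, Polynomial.eval_mul,
    show -(1 * s) = -(1 / 2 * s) + -(1 / 2 * s) by ring, Real.exp_add]
  ring

theorem integrableOn_laguerreFun_mul {d : ℕ} (n m : Fin d → ℕ) :
    MeasureTheory.IntegrableOn (fun x => laguerreFun n x * laguerreFun m x) (orthant d) := by
  rw [MeasureTheory.IntegrableOn, volume_restrict_orthant]
  simp_rw [laguerreFun_eq_prod, ← Finset.prod_mul_distrib]
  exact MeasureTheory.Integrable.fintype_prod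
    (f := fun j s => laguerreFunOne (n j) s * laguerreFunOne (m j) s)
    fun j => integrableOn_laguerreFunOne_mul (n j) (m j)

/-- The Laguerre functions are orthonormal on the orthant. -/
theorem integral_laguerreFun_mul {d : ℕ} (n m : Fin d → ℕ) :
    ∫ x in orthant d, laguerreFun n x * laguerreFun m x = if n = m then 1 else 0 := by
  rw [volume_restrict_orthant]
  simp_rw [laguerreFun_eq_prod, ← Finset.prod_mul_distrib]
  rw [MeasureTheory.integral_fintype_prod_eq_prod
    (f := fun j s => laguerreFunOne (n j) s * laguerreFunOne (m j) s)]
  simp_rw [integral_laguerreFunOne_mul]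
  split_ifs with h
  · simp [h]
  · obtain ⟨j, hj⟩ := Function.ne_iff.mp h
    exact Finset.prod_eq_zero (Finset.mem_univ j) (if_neg hj)

theorem abs_laguerreFun_le {d : ℕ} (n : Fin d → ℕ) {x : Fin d → ℝ} (hx : x ∈ orthant d) :
    |laguerreFun n x| ≤ 3 ^ d * ∏ j, ((n j : ℝ) + 1) := by
  rw [laguerreFun_eq_prod, Finset.abs_prod]
  calc _ ≤ ∏ j, (3 * ((n j : ℝ) + 1)) :=
        Finset.prod_le_prod (fun _ _ => abs_nonneg _)
          fun j _ => abs_laguerreFunOne_le (n j) (hx j).le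
    _ = _ := by simp [Finset.prod_mul_distrib]

/-! ### Laguerre series as integral operators, and the Abel limit. -/

theorem integral_norm_mul_laguerreFun_le {d : ℕ} {f : (Fin d → ℝ) → ℂ}
    (hf : MeasureTheory.IntegrableOn f (orthant d)) (n : Fin d → ℕ) :
    MeasureTheory.IntegrableOn (fun x => f x * (laguerreFun n x : ℂ)) (orthant d) ∧
    ∫ x in orthant d, ‖f x * (laguerreFun n x : ℂ)‖ ≤
      (∫ x in orthant d, ‖f x‖) * (3 ^ d * ∏ j, ((n j : ℝ) + 1)) := by
  have hb : ∀ᵐ x ∂(MeasureTheory.volume.restrict (orthant d)),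
      ‖(laguerreFun n x : ℂ)‖ ≤ 3 ^ d * ∏ j, ((n j : ℝ) + 1) := by
    filter_upwards [MeasureTheory.ae_restrict_mem (measurableSet_orthant d)] with x hx
    rw [Complex.norm_real]
    exact abs_laguerreFun_le n hx
  have hi : MeasureTheory.IntegrableOn (fun x => f x * (laguerreFun n x : ℂ)) (orthant d) :=
    MeasureTheory.Integrable.mul_bdd hf
      (Complex.continuous_ofReal.comp (continuous_laguerreFun n)).aestronglyMeasurable hb
  refine ⟨hi, ?_⟩
  rw [← MeasureTheory.integral_mul_const]
  refine MeasureTheory.integral_mono_ae hi.norm (hf.norm.mul_const _) ?_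
  filter_upwards [hb] with x hx
  rw [norm_mul]
  gcongr

/-- For `|w| < 1` the Laguerre series of `f` with multiplier `w^{|n|}` is an integral operator. -/
theorem hasSum_pow_mul_laguerreCoeff {d : ℕ} {f : (Fin d → ℝ) → ℂ}
    (hf : MeasureTheory.IntegrableOn f (orthant d)) {w : ℂ} (hw : ‖w‖ < 1) {x : Fin d → ℝ}
    (hx : x ∈ orthant d) :
    HasSum (fun n : Fin d → ℕ => w ^ (∑ j, n j) * laguerreCoeff f n * (laguerreFun n x : ℂ))
      (∫ y in orthant d, f y * ∏ j, kernelOne w (x j) (y j)) := by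
  -- One factor n + 1 bounds l_n(x), the other comes from the integral of |f l_n|.
  have hgeo : Summable fun n : ℕ => ‖((n : ℝ) + 1) * ((n : ℝ) + 1) * ‖w‖ ^ n‖ := by
    have h2 := summable_pow_mul_geometric_of_norm_lt_one 2 (r := ‖w‖) (by simpa using hw)
    have h1 := summable_pow_mul_geometric_of_norm_lt_one 1 (r := ‖w‖) (by simpa using hw)
    have h0 := summable_pow_mul_geometric_of_norm_lt_one 0 (r := ‖w‖) (by simpa using hw)
    refine ((h2.add (h1.mul_left 2)).add h0).congr fun n => ?_
    rw [Real.norm_of_nonneg (by positivity)]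
    ring
  have hW := (hasSum_fin_prod (d := d) (fun _ => hgeo) (fun _ => hgeo.of_norm.hasSum)).2
  have hsum : Summable fun n : Fin d → ℕ => ∫ y in orthant d,
      ‖w ^ (∑ j, n j) * (laguerreFun n x : ℂ) * (f y * (laguerreFun n y : ℂ))‖ := by
    refine Summable.of_nonneg_of_le (fun n => MeasureTheory.integral_nonneg fun _ => norm_nonneg _)
      (fun n => ?_) (hW.mul_left (3 ^ d * 3 ^ d * ∫ y in orthant d, ‖f y‖))
    simp_rw [norm_mul (w ^ (∑ j, n j) * (laguerreFun n x : ℂ))]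
    rw [MeasureTheory.integral_const_mul, norm_mul, norm_pow, Complex.norm_real]
    have h1 := abs_laguerreFun_le n hx
    have h2 := (integral_norm_mul_laguerreFun_le hf n).2
    have h3 : 0 ≤ ∫ y in orthant d, ‖f y * (laguerreFun n y : ℂ)‖ :=
      MeasureTheory.integral_nonneg fun _ => norm_nonneg _
    calc ‖w‖ ^ (∑ j, n j) * ‖laguerreFun n x‖ * ∫ y in orthant d, ‖f y * (laguerreFun n y : ℂ)‖
        ≤ ‖w‖ ^ (∑ j, n j) * (3 ^ d * ∏ j, ((n j : ℝ) + 1)) *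
          ((∫ x in orthant d, ‖f x‖) * (3 ^ d * ∏ j, ((n j : ℝ) + 1))) := by
          rw [Real.norm_eq_abs]
          gcongr
      _ = _ := by
          rw [Real.norm_of_nonneg (by positivity), Finset.prod_mul_distrib,
            Finset.prod_mul_distrib, Finset.prod_pow_eq_pow_sum]
          ring
  have h := MeasureTheory.hasSum_integral_of_summable_integral_norm
    (fun n => ((integral_norm_mul_laguerreFun_le hf n).1.const_mul
      (w ^ (∑ j, n j) * (laguerreFun n x : ℂ)))) hsum
  convert! h using 1
  · ext n
    rw [MeasureTheory.integral_const_mul, laguerreCoeff]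
    ring
  · refine MeasureTheory.integral_congr_ae (Filter.Eventually.of_forall fun y => ?_)
    simp only []
    have hone : ∀ j, Summable fun n : ℕ =>
        ‖w ^ n * (laguerreFunOne n (x j) : ℂ) * (laguerreFunOne n (y j) : ℂ)‖ := fun j =>
      (hasSum_laguerreFunOne hw (x j) (y j)).summable.norm
    have hk := (hasSum_fin_prod hone fun j => hasSum_laguerreFunOne hw (x j) (y j)).1
    rw [← (hk.mul_left (f y)).tsum_eq]
    refine tsum_congr fun n => ?_
    rw [Finset.prod_mul_distrib, Finset.prod_mul_distrib, Finset.prod_pow_eq_pow_sum,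
      laguerreFun_eq_prod, laguerreFun_eq_prod]
    push_cast
    ring

theorem continuous_prod_kernelOne {d : ℕ} (w : ℂ) (x : Fin d → ℝ) :
    Continuous fun y : Fin d → ℝ => ∏ j, kernelOne w (x j) (y j) :=
  continuous_finsetProd _ fun j _ => (continuous_kernelOne w (x j)).comp (continuous_apply j)

theorem norm_prod_kernelOne_le {d : ℕ} {w : ℂ} (hw : ‖w‖ ≤ 1) (hw1 : w ≠ 1) {x y : Fin d → ℝ}
    (hx : x ∈ orthant d) (hy : y ∈ orthant d) :
    ‖∏ j, kernelOne w (x j) (y j)‖ ≤ (‖1 - w‖⁻¹) ^ d := by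
  rw [norm_prod]
  calc _ ≤ ∏ _j : Fin d, ‖1 - w‖⁻¹ := Finset.prod_le_prod (fun _ _ => norm_nonneg _)
        fun j _ => norm_kernelOne_le hw hw1 (hx j).le (hy j).le
    _ = _ := by simp

theorem integrableOn_mul_prod_kernelOne {d : ℕ} {f : (Fin d → ℝ) → ℂ}
    (hf : MeasureTheory.IntegrableOn f (orthant d)) {w : ℂ} (hw : ‖w‖ ≤ 1) (hw1 : w ≠ 1)
    {x : Fin d → ℝ} (hx : x ∈ orthant d) :
    MeasureTheory.IntegrableOn (fun y => f y * ∏ j, kernelOne w (x j) (y j)) (orthant d) := by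
  refine MeasureTheory.Integrable.mul_bdd (c := (‖1 - w‖⁻¹) ^ d) hf
    (continuous_prod_kernelOne w x).aestronglyMeasurable ?_
  filter_upwards [MeasureTheory.ae_restrict_mem (measurableSet_orthant d)] with y hy
  exact norm_prod_kernelOne_le hw hw1 hx hy

theorem summable_norm_mul_laguerreFun {d : ℕ} {c : (Fin d → ℕ) → ℂ}
    (hc : Summable fun n : Fin d → ℕ => ‖c n‖ * ∏ j, ((n j : ℝ) + 1)) {x : Fin d → ℝ}
    (hx : x ∈ orthant d) : Summable fun n => ‖c n * (laguerreFun n x : ℂ)‖ := by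
  refine Summable.of_nonneg_of_le (fun _ => norm_nonneg _) (fun n => ?_) (hc.mul_left (3 ^ d))
  rw [norm_mul, Complex.norm_real, mul_left_comm]
  gcongr
  exact abs_laguerreFun_le n hx

/-- The limiting case `|w| = 1`, `w ≠ 1` of `hasSum_pow_mul_laguerreCoeff`, by Abel summation. -/
theorem tsum_pow_mul_laguerreCoeff {d : ℕ} {f : (Fin d → ℝ) → ℂ}
    (hf : MeasureTheory.IntegrableOn f (orthant d))
    (hc : Summable fun n : Fin d → ℕ => ‖laguerreCoeff f n‖ * ∏ j, ((n j : ℝ) + 1)) {w : ℂ}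
    (hw : ‖w‖ = 1) (hw1 : w ≠ 1) {x : Fin d → ℝ} (hx : x ∈ orthant d) :
    ∑' n : Fin d → ℕ, w ^ (∑ j, n j) * laguerreCoeff f n * (laguerreFun n x : ℂ) =
      ∫ y in orthant d, f y * ∏ j, kernelOne w (x j) (y j) := by
  have hcont : Filter.Tendsto (fun r : ℝ => (r : ℂ) * w) (nhdsWithin 1 (Set.Iio 1)) (nhds w) := by
    have : ContinuousAt (fun r : ℝ => (r : ℂ) * w) 1 := by fun_prop
    simpa using this.tendsto.mono_left nhdsWithin_le_nhds
  have hr : ∀ᶠ r : ℝ in nhdsWithin 1 (Set.Iio 1), 0 < r ∧ r < 1 := by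
    filter_upwards [Ioo_mem_nhdsLT (zero_lt_one' ℝ)] with r hr
    exact hr
  have hnorm : ∀ r : ℝ, 0 < r → ‖(r : ℂ) * w‖ = r := fun r h => by
    rw [norm_mul, hw, mul_one, Complex.norm_real, Real.norm_of_nonneg h.le]
  have hpos : 0 < ‖1 - w‖ := norm_pos_iff.mpr (sub_ne_zero.mpr (Ne.symm hw1))
  -- Near the limit rw stays away from 1, so a single constant bounds all the kernels.
  have hbd : ∀ᶠ r : ℝ in nhdsWithin 1 (Set.Iio 1), ‖1 - w‖ / 2 < ‖1 - (r : ℂ) * w‖ :=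
    (((tendsto_const_nhds (x := (1 : ℂ))).sub hcont).norm).eventually_const_lt (half_lt_self hpos)
  have hL : Filter.Tendsto (fun r : ℝ => ∑' n : Fin d → ℕ,
      ((r : ℂ) * w) ^ (∑ j, n j) * laguerreCoeff f n * (laguerreFun n x : ℂ))
      (nhdsWithin 1 (Set.Iio 1)) (nhds (∑' n : Fin d → ℕ,
        w ^ (∑ j, n j) * laguerreCoeff f n * (laguerreFun n x : ℂ))) := by
    refine tendsto_tsum_of_dominated_convergence (summable_norm_mul_laguerreFun hc hx)
      (fun n => ((hcont.pow _).mul_const _).mul_const _) ?_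
    filter_upwards [hr] with r hr n
    rw [mul_assoc, norm_mul, norm_pow, hnorm r hr.1]
    exact mul_le_of_le_one_left (norm_nonneg _) (pow_le_one₀ hr.1.le hr.2.le)
  have hR : Filter.Tendsto (fun r : ℝ => ∫ y in orthant d,
      f y * ∏ j, kernelOne ((r : ℂ) * w) (x j) (y j)) (nhdsWithin 1 (Set.Iio 1))
      (nhds (∫ y in orthant d, f y * ∏ j, kernelOne w (x j) (y j))) := by
    refine MeasureTheory.tendsto_integral_filter_of_dominated_convergence
      (fun y => ‖f y‖ * ((‖1 - w‖ / 2)⁻¹) ^ d) ?_ ?_ (hf.norm.mul_const _) ?_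
    · exact Filter.Eventually.of_forall fun r => hf.1.mul
        (continuous_prod_kernelOne _ x).aestronglyMeasurable
    · filter_upwards [hr, hbd] with r hr hb
      filter_upwards [MeasureTheory.ae_restrict_mem (measurableSet_orthant d)] with y hy
      have hne : (r : ℂ) * w ≠ 1 := fun h => by
        have := hnorm r hr.1
        rw [h, norm_one] at this
        linarith [hr.2]
      rw [norm_mul]
      gcongr
      refine (norm_prod_kernelOne_le ((hnorm r hr.1).trans_le hr.2.le) hne hx hy).trans ?_
      gcongr
    · refine Filter.Eventually.of_forall fun y => Filter.Tendsto.const_mul _ ?_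
      exact tendsto_finsetProd _ fun j _ => (continuousAt_kernelOne hw1 (x j) (y j)).tendsto.comp
        hcont
  refine tendsto_nhds_unique hL (hR.congr' ?_)
  filter_upwards [hr] with r hr
  exact (hasSum_pow_mul_laguerreCoeff hf ((hnorm r hr.1).trans_lt hr.2) hx).tsum_eq.symm

/-! ### Coefficients and square integrability of Laguerre series. -/

/-- An absolutely convergent Laguerre series has the prescribed Laguerre coefficients. -/
theorem laguerreCoeff_tsum {d : ℕ} {c : (Fin d → ℕ) → ℂ} (hc : Summable fun n => ‖c n‖)
    (m : Fin d → ℕ) :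
    laguerreCoeff (fun x => ∑' n, c n * (laguerreFun n x : ℂ)) m = c m := by
  have hint : ∀ n, MeasureTheory.IntegrableOn
      (fun x => c n * ((laguerreFun n x * laguerreFun m x : ℝ) : ℂ)) (orthant d) := fun n =>
    (integrableOn_laguerreFun_mul n m).ofReal.const_mul _
  -- 2|ab| ≤ a² + b² and normalisation give a bound uniform in n, which justifies termwise
  -- integration.
  have hone : ∀ n : Fin d → ℕ, ∫ x in orthant d, |laguerreFun n x * laguerreFun m x| ≤ 1 := by
    intro n
    have h1 := integrableOn_laguerreFun_mul n n
    have h2 := integrableOn_laguerreFun_mul m m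
    calc ∫ x in orthant d, |laguerreFun n x * laguerreFun m x|
        ≤ ∫ x in orthant d, (1 / 2 * (laguerreFun n x * laguerreFun n x) +
          1 / 2 * (laguerreFun m x * laguerreFun m x)) := by
          refine MeasureTheory.integral_mono (integrableOn_laguerreFun_mul n m).abs
            ((h1.const_mul _).add (h2.const_mul _)) fun x => ?_
          simp only []
          rw [abs_mul]
          nlinarith [sq_nonneg (|laguerreFun n x| - |laguerreFun m x|),
            abs_mul_abs_self (laguerreFun n x), abs_mul_abs_self (laguerreFun m x)]
      _ = 1 := by
          rw [MeasureTheory.integral_add (h1.const_mul _) (h2.const_mul _),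
            MeasureTheory.integral_const_mul, MeasureTheory.integral_const_mul,
            integral_laguerreFun_mul, integral_laguerreFun_mul, if_pos rfl, if_pos rfl]
          norm_num
  have hsum : Summable fun n => ∫ x in orthant d,
      ‖c n * ((laguerreFun n x * laguerreFun m x : ℝ) : ℂ)‖ := by
    refine Summable.of_nonneg_of_le (fun n => MeasureTheory.integral_nonneg fun _ => norm_nonneg _)
      (fun n => ?_) hc
    simp_rw [norm_mul, MeasureTheory.integral_const_mul, Complex.norm_real]
    exact mul_le_of_le_one_right (norm_nonneg _) (hone n)
  have h := MeasureTheory.hasSum_integral_of_summable_integral_norm hint hsum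
  have hval : ∀ n, ∫ x in orthant d, c n * ((laguerreFun n x * laguerreFun m x : ℝ) : ℂ) =
      if n = m then c n else 0 := by
    intro n
    rw [MeasureTheory.integral_const_mul, integral_complex_ofReal, integral_laguerreFun_mul]
    split_ifs <;> simp
  simp_rw [hval] at h
  have hm : HasSum (fun n => if n = m then c n else 0) (c m) := by
    simpa using hasSum_single (f := fun n => if n = m then c n else 0) m
      fun n hn => if_neg hn
  rw [laguerreCoeff, ← h.unique hm]
  refine MeasureTheory.integral_congr_ae (Filter.Eventually.of_forall fun x => ?_)
  simp only []
  rw [← tsum_mul_right]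
  refine tsum_congr fun n => ?_
  push_cast
  ring

theorem memLp_laguerreFun {d : ℕ} (n : Fin d → ℕ) :
    MeasureTheory.MemLp (fun x => (laguerreFun n x : ℂ)) 2
      (MeasureTheory.volume.restrict (orthant d)) := by
  have hm : MeasureTheory.AEStronglyMeasurable (fun x => (laguerreFun n x : ℂ))
      (MeasureTheory.volume.restrict (orthant d)) :=
    (Complex.continuous_ofReal.comp (continuous_laguerreFun n)).aestronglyMeasurable
  rw [MeasureTheory.memLp_two_iff_integrable_sq_norm hm]
  refine (integrableOn_laguerreFun_mul n n).congr (Filter.Eventually.of_forall fun x => ?_)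
  simp only [Complex.norm_real, Real.norm_eq_abs, sq_abs]
  ring

theorem eLpNorm_laguerreFun {d : ℕ} (n : Fin d → ℕ) :
    MeasureTheory.eLpNorm (fun x => (laguerreFun n x : ℂ)) 2
      (MeasureTheory.volume.restrict (orthant d)) = 1 := by
  rw [(memLp_laguerreFun n).eLpNorm_eq_integral_rpow_norm (by norm_num) (by norm_num)]
  have : ∀ x, ‖(laguerreFun n x : ℂ)‖ ^ (2 : ENNReal).toReal =
      laguerreFun n x * laguerreFun n x := by
    intro x
    simp [← pow_two]
  simp_rw [this, integral_laguerreFun_mul]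
  simp

/-- An absolutely convergent Laguerre series is square integrable. -/
theorem memLp_two_tsum_laguerreFun {d : ℕ} {c : (Fin d → ℕ) → ℂ}
    (hc : Summable fun n : Fin d → ℕ => ‖c n‖) :
    MeasureTheory.MemLp (fun x => ∑' n, c n * (laguerreFun n x : ℂ)) 2
      (MeasureTheory.volume.restrict (orthant d)) := by
  have hmem : ∀ n, MeasureTheory.MemLp (fun x => c n * (laguerreFun n x : ℂ)) 2
      (MeasureTheory.volume.restrict (orthant d)) := fun n => (memLp_laguerreFun n).const_mul _
  have hnorm : ∀ n, ‖(hmem n).toLp‖ₑ = ‖c n‖ₑ := by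
    intro n
    rw [MeasureTheory.Lp.enorm_toLp, show (fun x => c n * (laguerreFun n x : ℂ)) =
      c n • fun x => (laguerreFun n x : ℂ) from rfl, MeasureTheory.eLpNorm_const_smul,
      eLpNorm_laguerreFun, mul_one]
  have hfin : ∑' n, ‖(hmem n).toLp‖ₑ ≠ ⊤ := by
    simp_rw [hnorm]
    exact tsum_enorm_ne_top_iff_summable_norm.mpr hc
  -- The series converges in norm in the complete space L², and its L² sum agrees almost everywhere
  -- with the pointwise sum.
  refine (MeasureTheory.memLp_congr_ae ?_).mp
    (MeasureTheory.Lp.memLp (∑' n, (hmem n).toLp))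
  filter_upwards [MeasureTheory.Lp.coeFn_tsum hfin,
    MeasureTheory.ae_all_iff.mpr fun n => (hmem n).coeFn_toLp] with x hx hx'
  rw [hx]
  exact tsum_congr fun n => hx' n

/-! ### Stability of the Schwartz class on the orthant. -/

/-- The product of `f` with the `j`-th coordinate function. -/
def coordMul {d : ℕ} (j : Fin d) (f : (Fin d → ℝ) → ℂ) : (Fin d → ℝ) → ℂ :=
  fun x => (x j : ℂ) * f x

/-- The condition that `IsSchwartzOnOrthant` imposes on each single derivative. -/
def IsRapidOnOrthant {d : ℕ} (h : (Fin d → ℝ) → ℂ) : Prop :=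
  (∃ g : (Fin d → ℝ) → ℂ, ContinuousOn g (closure (orthant d)) ∧ Set.EqOn h g (orthant d)) ∧
    ∀ β : Fin d → ℕ, ∃ C : ℝ, ∀ x ∈ orthant d, (∏ j, x j ^ β j) * ‖h x‖ ≤ C

theorem IsSchwartzOnOrthant.rapid {d : ℕ} {f : (Fin d → ℝ) → ℂ} (hf : IsSchwartzOnOrthant f)
    (v : List (Fin d)) : IsRapidOnOrthant (iterPDeriv v f) :=
  ⟨hf.extends_closure v, hf.decay v⟩

theorem isSchwartzOnOrthant_of_rapid {d : ℕ} {f : (Fin d → ℝ) → ℂ}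
    (h1 : ContDiffOn ℝ ∞ f (orthant d)) (h2 : ∀ v, IsRapidOnOrthant (iterPDeriv v f)) :
    IsSchwartzOnOrthant f :=
  ⟨h1, fun v => (h2 v).1, fun v => (h2 v).2⟩

namespace IsRapidOnOrthant

variable {d : ℕ} {h k : (Fin d → ℝ) → ℂ}

theorem congr (hh : IsRapidOnOrthant h) (hk : Set.EqOn k h (orthant d)) :
    IsRapidOnOrthant k := by
  obtain ⟨⟨g, hg, hgh⟩, hb⟩ := hh
  refine ⟨⟨g, hg, hk.trans hgh⟩, fun β => ?_⟩
  obtain ⟨C, hC⟩ := hb β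
  exact ⟨C, fun x hx => by rw [hk hx]; exact hC x hx⟩

theorem add (hh : IsRapidOnOrthant h) (hk : IsRapidOnOrthant k) :
    IsRapidOnOrthant (fun x => h x + k x) := by
  obtain ⟨⟨g, hg, hgh⟩, hb⟩ := hh
  obtain ⟨⟨g', hg', hgh'⟩, hb'⟩ := hk
  refine ⟨⟨fun x => g x + g' x, hg.add hg', fun x hx => by
    simp only [hgh hx, hgh' hx]⟩, fun β => ?_⟩
  obtain ⟨C, hC⟩ := hb β
  obtain ⟨C', hC'⟩ := hb' β
  refine ⟨C + C', fun x hx => ?_⟩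
  have h0 : 0 ≤ ∏ j, x j ^ β j := Finset.prod_nonneg fun j _ => pow_nonneg (hx j).le _
  calc _ ≤ (∏ j, x j ^ β j) * (‖h x‖ + ‖k x‖) := by gcongr; exact norm_add_le _ _
    _ ≤ _ := by rw [mul_add]; exact add_le_add (hC x hx) (hC' x hx)

theorem const_mul (c : ℂ) (hh : IsRapidOnOrthant h) : IsRapidOnOrthant (fun x => c * h x) := by
  obtain ⟨⟨g, hg, hgh⟩, hb⟩ := hh
  refine ⟨⟨fun x => c * g x, continuousOn_const.mul hg, fun x hx => by
    simp only [hgh hx]⟩, fun β => ?_⟩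
  obtain ⟨C, hC⟩ := hb β
  refine ⟨‖c‖ * C, fun x hx => ?_⟩
  rw [norm_mul, mul_left_comm]
  gcongr
  exact hC x hx

theorem coordMul (j : Fin d) (hh : IsRapidOnOrthant h) :
    IsRapidOnOrthant (coordMul j h) := by
  obtain ⟨⟨g, hg, hgh⟩, hb⟩ := hh
  refine ⟨⟨fun x => (x j : ℂ) * g x, ContinuousOn.mul (by fun_prop) hg, fun x hx => by
    simp only [_root_.coordMul, hgh hx]⟩, fun β => ?_⟩
  obtain ⟨C, hC⟩ := hb (β + Pi.single j 1)
  refine ⟨C, fun x hx => (le_of_eq ?_).trans (hC x hx)⟩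
  have : ∏ i, x i ^ (β + Pi.single j 1 : Fin d → ℕ) i = (∏ i, x i ^ β i) * x j := by
    simp_rw [Pi.add_apply, pow_add, Finset.prod_mul_distrib]
    congr 1
    rw [Finset.prod_eq_single j]
    · simp
    · intro i _ hi
      simp [hi]
    · simp
  rw [this, _root_.coordMul, norm_mul, Complex.norm_real, Real.norm_of_nonneg (hx j).le]
  ring

end IsRapidOnOrthant

section Derivatives

variable {d : ℕ} {f g : (Fin d → ℝ) → ℂ}

theorem ContDiffOn.pderiv (hf : ContDiffOn ℝ ∞ f (orthant d)) (j : Fin d) :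
    ContDiffOn ℝ ∞ (pderiv j f) (orthant d) :=
  (hf.fderiv_of_isOpen (isOpen_orthant d) (by simp)).clm_apply contDiffOn_const

theorem ContDiffOn.iterPDeriv (hf : ContDiffOn ℝ ∞ f (orthant d)) (v : List (Fin d)) :
    ContDiffOn ℝ ∞ (iterPDeriv v f) (orthant d) := by
  induction v with
  | nil => exact hf
  | cons i v ih => exact ih.pderiv i

theorem ContDiffOn.differentiableAt_orthant (hf : ContDiffOn ℝ ∞ f (orthant d))
    {x : Fin d → ℝ} (hx : x ∈ orthant d) : DifferentiableAt ℝ f x :=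
  (hf.differentiableOn (by simp)).differentiableAt ((isOpen_orthant d).mem_nhds hx)

/-- The orthant is open, so equality on it is equality of germs at each of its points; values
outside are irrelevant. -/
theorem pderiv_congr (h : Set.EqOn f g (orthant d)) (j : Fin d) :
    Set.EqOn (pderiv j f) (pderiv j g) (orthant d) := fun x hx => by
  have : f =ᶠ[nhds x] g := h.eventuallyEq_of_mem ((isOpen_orthant d).mem_nhds hx)
  simp only [pderiv, this.fderiv_eq]

theorem pderiv_add (hf : ContDiffOn ℝ ∞ f (orthant d)) (hg : ContDiffOn ℝ ∞ g (orthant d))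
    (j : Fin d) : Set.EqOn (pderiv j fun x => f x + g x) (fun x => pderiv j f x + pderiv j g x)
      (orthant d) := fun x hx => by
  simp only [pderiv]
  rw [fderiv_fun_add (hf.differentiableAt_orthant hx) (hg.differentiableAt_orthant hx)]
  rfl

theorem pderiv_const_mul (c : ℂ) (hf : ContDiffOn ℝ ∞ f (orthant d))
    (j : Fin d) : Set.EqOn (pderiv j fun x => c * f x) (fun x => c * pderiv j f x)
      (orthant d) := fun x hx => by
  simp only [pderiv]
  rw [fderiv_const_mul (hf.differentiableAt_orthant hx)]
  rfl

theorem pderiv_coordMul (hf : ContDiffOn ℝ ∞ f (orthant d)) (i j : Fin d) :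
    Set.EqOn (pderiv i (coordMul j f))
      (fun x => coordMul j (pderiv i f) x + (if i = j then 1 else 0) * f x)
      (orthant d) := fun x hx => by
  have h1 : HasFDerivAt (fun x : Fin d → ℝ => (x j : ℂ))
      (Complex.ofRealCLM.comp (ContinuousLinearMap.proj (R := ℝ) (φ := fun _ : Fin d => ℝ) j)) x :=
    (Complex.ofRealCLM.comp (ContinuousLinearMap.proj (R := ℝ) (φ := fun _ : Fin d => ℝ) j)).hasFDerivAt
  have h2 := h1.mul (hf.differentiableAt_orthant hx).hasFDerivAt
  have h3 : fderiv ℝ (coordMul j f) x = _ := h2.fderiv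
  simp only [pderiv]
  rw [h3]
  by_cases hij : i = j
  · simp [coordMul, pderiv, hij, mul_comm]
  · simp [coordMul, pderiv, hij, Ne.symm hij, mul_comm]

theorem contDiffOn_coordMul (hf : ContDiffOn ℝ ∞ f (orthant d)) (j : Fin d) :
    ContDiffOn ℝ ∞ (coordMul j f) (orthant d) := by
  refine ContDiffOn.mul (ContDiff.contDiffOn ?_) hf
  exact Complex.ofRealCLM.contDiff.comp (contDiff_apply ℝ ℝ j)

theorem iterPDeriv_add (hf : ContDiffOn ℝ ∞ f (orthant d)) (hg : ContDiffOn ℝ ∞ g (orthant d))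
    (v : List (Fin d)) : Set.EqOn (iterPDeriv v fun x => f x + g x)
      (fun x => iterPDeriv v f x + iterPDeriv v g x) (orthant d) := by
  induction v with
  | nil => exact fun x _ => rfl
  | cons i v ih =>
    exact (pderiv_congr ih i).trans (pderiv_add (hf.iterPDeriv v) (hg.iterPDeriv v) i)

theorem iterPDeriv_const_mul (c : ℂ) (hf : ContDiffOn ℝ ∞ f (orthant d))
    (v : List (Fin d)) : Set.EqOn (iterPDeriv v fun x => c * f x)
      (fun x => c * iterPDeriv v f x) (orthant d) := by
  induction v with
  | nil => exact fun x _ => rfl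
  | cons i v ih => exact (pderiv_congr ih i).trans (pderiv_const_mul c (hf.iterPDeriv v) i)

end Derivatives

namespace IsSchwartzOnOrthant

variable {d : ℕ} {f g : (Fin d → ℝ) → ℂ}

theorem add (hf : IsSchwartzOnOrthant f) (hg : IsSchwartzOnOrthant g) :
    IsSchwartzOnOrthant (fun x => f x + g x) :=
  isSchwartzOnOrthant_of_rapid (hf.smooth.add hg.smooth) fun v =>
    ((hf.rapid v).add (hg.rapid v)).congr (iterPDeriv_add hf.smooth hg.smooth v)

theorem const_mul (c : ℂ) (hf : IsSchwartzOnOrthant f) :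
    IsSchwartzOnOrthant (fun x => c * f x) :=
  isSchwartzOnOrthant_of_rapid (contDiffOn_const.mul hf.smooth) fun v =>
    ((hf.rapid v).const_mul c).congr (iterPDeriv_const_mul c hf.smooth v)

theorem pderiv (hf : IsSchwartzOnOrthant f) (j : Fin d) : IsSchwartzOnOrthant (pderiv j f) :=
  isSchwartzOnOrthant_of_rapid (hf.smooth.pderiv j) fun v => by
    have := hf.rapid (v ++ [j])
    rwa [iterPDeriv, List.foldr_append] at this

theorem iterPDeriv (hf : IsSchwartzOnOrthant f) (v : List (Fin d)) :
    IsSchwartzOnOrthant (iterPDeriv v f) := by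
  induction v with
  | nil => exact hf
  | cons i v ih => exact ih.pderiv i

/-- The commutator of `∂^v` with a coordinate maps Schwartz functions to Schwartz functions. -/
theorem exists_iterPDeriv_coordMul (hf : IsSchwartzOnOrthant f) (j : Fin d) (v : List (Fin d)) :
    ∃ r : (Fin d → ℝ) → ℂ, IsSchwartzOnOrthant r ∧
      Set.EqOn (_root_.iterPDeriv v (_root_.coordMul j f))
        (fun x => _root_.coordMul j (_root_.iterPDeriv v f) x + r x) (orthant d) := by
  induction v with
  | nil =>
    refine ⟨fun x => 0 * f x, hf.const_mul 0, fun x _ => ?_⟩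
    simp [_root_.iterPDeriv]
  | cons i v ih =>
    obtain ⟨r, hr, he⟩ := ih
    refine ⟨fun x => (if i = j then 1 else 0) * _root_.iterPDeriv v f x + _root_.pderiv i r x,
      ((hf.iterPDeriv v).const_mul _).add (hr.pderiv i), ?_⟩
    have h1 := pderiv_congr he i
    have hs := hf.smooth.iterPDeriv v
    have h2 := pderiv_add (contDiffOn_coordMul hs j) hr.smooth i
    have h3 := pderiv_coordMul hs i j
    intro x hx
    refine (h1 hx).trans ((h2 hx).trans ?_)
    simp only [h3 hx]
    exact add_assoc _ _ _

theorem coordMul (hf : IsSchwartzOnOrthant f) (j : Fin d) :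
    IsSchwartzOnOrthant (coordMul j f) :=
  isSchwartzOnOrthant_of_rapid (contDiffOn_coordMul hf.smooth j) fun v => by
    obtain ⟨r, hr, he⟩ := hf.exists_iterPDeriv_coordMul j v
    exact (((hf.rapid v).coordMul j).add (hr.rapid [])).congr he

theorem exists_bound (hf : IsSchwartzOnOrthant f) : ∃ C : ℝ, ∀ x ∈ orthant d, ‖f x‖ ≤ C := by
  obtain ⟨C, hC⟩ := hf.decay [] 0
  exact ⟨C, fun x hx => by simpa [_root_.iterPDeriv] using hC x hx⟩

/-- Adding the decay bounds over all exponents β ∈ {0,2}^d bounds ∏(1 + x_j²)|f|, and ∏(1 + x_j²)⁻¹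
is an integrable product. -/
theorem integrableOn (hf : IsSchwartzOnOrthant f) :
    MeasureTheory.IntegrableOn f (orthant d) := by
  have hdec : ∃ C : ℝ, ∀ x ∈ orthant d, (∏ j, (1 + x j ^ 2)) * ‖f x‖ ≤ C := by
    choose C hC using fun β => hf.decay [] β
    refine ⟨∑ t ∈ (Finset.univ : Finset (Fin d)).powerset, C fun j => if j ∈ t then 2 else 0,
      fun x hx => ?_⟩
    rw [Finset.prod_one_add, Finset.sum_mul]
    refine Finset.sum_le_sum fun t _ => ?_
    have h := hC (fun j => if j ∈ t then 2 else 0) x hx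
    have h2 : ∏ j, x j ^ (if j ∈ t then 2 else 0) = ∏ j ∈ t, x j ^ 2 := by
      simp_rw [pow_ite, pow_zero]
      rw [Finset.prod_ite_mem, Finset.univ_inter]
    rwa [h2] at h
  obtain ⟨C, hC⟩ := hdec
  have hi : MeasureTheory.IntegrableOn (fun x : Fin d → ℝ => C * ∏ j, (1 + x j ^ 2)⁻¹)
      (orthant d) := by
    rw [MeasureTheory.IntegrableOn, volume_restrict_orthant]
    exact (MeasureTheory.Integrable.fintype_prod (f := fun (_ : Fin d) (s : ℝ) => (1 + s ^ 2)⁻¹)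
      fun _ => integrable_inv_one_add_sq.integrableOn).const_mul C
  refine MeasureTheory.Integrable.mono' hi
    (hf.smooth.continuousOn.aestronglyMeasurable (measurableSet_orthant d)) ?_
  filter_upwards [MeasureTheory.ae_restrict_mem (measurableSet_orthant d)] with x hx
  have hp : 0 < ∏ j, (1 + x j ^ 2) := Finset.prod_pos fun j _ => by positivity
  rw [Finset.prod_inv_distrib, ← div_eq_mul_inv, le_div_iff₀ hp, mul_comm]
  exact hC x hx

end IsSchwartzOnOrthant

/-! ### Decay of the Laguerre coefficients. -/

/-- The operator `1 + E_j`, where `E_j = -(x_j ∂_j² + ∂_j - x_j/4 + 1/2)`. -/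
def oneAddLaguerreOp {d : ℕ} (j : Fin d) (f : (Fin d → ℝ) → ℂ) : (Fin d → ℝ) → ℂ :=
  fun x => (-1 * coordMul j (pderiv j (pderiv j f)) x + -1 * pderiv j f x) +
    (1 / 4 * coordMul j f x + 1 / 2 * f x)

theorem IsSchwartzOnOrthant.oneAddLaguerreOp {d : ℕ} {f : (Fin d → ℝ) → ℂ}
    (hf : IsSchwartzOnOrthant f) (j : Fin d) : IsSchwartzOnOrthant (oneAddLaguerreOp j f) :=
  ((((hf.pderiv j).pderiv j).coordMul j).const_mul (-1) |>.add ((hf.pderiv j).const_mul (-1))).add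
    (((hf.coordMul j).const_mul (1 / 4)).add (hf.const_mul (1 / 2)))

theorem integrableOn_polynomial_mul_exp_ofReal (p : Polynomial ℝ) :
    MeasureTheory.IntegrableOn (fun s : ℝ => ((p.eval s * Real.exp (-(1 / 2 * s)) : ℝ) : ℂ))
      (Set.Ioi 0) :=
  (polynomial_mul_exp_neg_integrableOn p one_half_pos).ofReal

/-- Integration by parts on the half-line against a Laguerre function. -/
theorem integral_laguerreOp_mul_laguerreFunOne {φ φ₁ φ₂ : ℝ → ℂ} {C : ℝ}
    (h1 : ∀ s ∈ Set.Ioi (0 : ℝ), HasDerivAt φ (φ₁ s) s)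
    (h2 : ∀ s ∈ Set.Ioi (0 : ℝ), HasDerivAt φ₁ (φ₂ s) s)
    (hc : ContinuousOn φ₂ (Set.Ioi 0)) (hb : ∀ s ∈ Set.Ioi (0 : ℝ), ‖φ s‖ ≤ C)
    (hb1 : ∀ s ∈ Set.Ioi (0 : ℝ), ‖φ₁ s‖ ≤ C) (hb2 : ∀ s ∈ Set.Ioi (0 : ℝ), ‖φ₂ s‖ ≤ C)
    (n : ℕ) :
    ∫ s in Set.Ioi (0 : ℝ), (-(s * φ₂ s) - φ₁ s + (s / 4 - 1 / 2 - n) * φ s) *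
      (laguerreFunOne n s : ℂ) = 0 := by
  -- G = s(φ l' - φ' l) is the Wronskian-type primitive of the integrand. Its factor s kills the
  -- boundary term at 0 whatever values φ and φ₁ take there, and the exponential in l kills the one
  -- at infinity.
  set G : ℝ → ℂ := fun s => φ s * ((s * laguerreFunOneDeriv n s : ℝ) : ℂ) -
    φ₁ s * ((s * laguerreFunOne n s : ℝ) : ℂ) with hG
  have hGb : ∀ s ∈ Set.Ici (0 : ℝ),
      ‖G s‖ ≤ C * (|s * laguerreFunOneDeriv n s| + |s * laguerreFunOne n s|) := by
    intro s hs
    rcases (Set.mem_Ici.mp hs).eq_or_lt with rfl | hs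
    · simp [hG]
    · refine (norm_sub_le _ _).trans ?_
      rw [norm_mul, norm_mul, Complex.norm_real, Complex.norm_real, mul_add]
      exact add_le_add (mul_le_mul_of_nonneg_right (hb s hs) (abs_nonneg _))
        (mul_le_mul_of_nonneg_right (hb1 s hs) (abs_nonneg _))
  have hG0 : G 0 = 0 := by simp [hG]
  have hcont : ContinuousWithinAt G (Set.Ici 0) 0 := by
    have hc1 : Continuous (laguerreFunOneDeriv n) := by unfold laguerreFunOneDeriv; fun_prop
    have hc2 := continuous_laguerreFunOne n
    have hB : Continuous fun s => C * (|s * laguerreFunOneDeriv n s| + |s * laguerreFunOne n s|) := by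
      fun_prop
    rw [ContinuousWithinAt, hG0]
    refine squeeze_zero_norm' (eventually_nhdsWithin_of_forall hGb) ?_
    simpa using (hB.tendsto 0).mono_left (nhdsWithin_le_nhds (s := Set.Ici (0 : ℝ)))
  have hinf : Filter.Tendsto G Filter.atTop (nhds 0) := by
    have t1 := polynomial_mul_exp_neg_tendsto (Polynomial.X *
      ((laguerrePolynomial n).derivative - Polynomial.C (1 / 2) * laguerrePolynomial n))
      one_half_pos
    have t2 := polynomial_mul_exp_neg_tendsto (Polynomial.X * laguerrePolynomial n) one_half_pos
    refine squeeze_zero_norm' ((Filter.eventually_ge_atTop 0).mono hGb) ?_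
    have := (t1.abs.add t2.abs).const_mul C
    simpa [laguerreFunOne_eq, laguerreFunOneDeriv, mul_assoc] using this
  have hder : ∀ s ∈ Set.Ioi (0 : ℝ), HasDerivAt G
      ((-(s * φ₂ s) - φ₁ s + (s / 4 - 1 / 2 - n) * φ s) * (laguerreFunOne n s : ℂ)) s := by
    intro s hs
    have e1 := (hasDerivAt_mul_laguerreFunOneDeriv n s).ofReal_comp
    have e2 := ((hasDerivAt_id s).mul (hasDerivAt_laguerreFunOne n s)).ofReal_comp
    refine (((h1 s hs).mul e1).sub ((h2 s hs).mul e2)).congr_deriv ?_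
    simp
    ring
  have hm1 : ContinuousOn φ₁ (Set.Ioi 0) := fun s hs => (h2 s hs).continuousAt.continuousWithinAt
  have hm0 : ContinuousOn φ (Set.Ioi 0) := fun s hs => (h1 s hs).continuousAt.continuousWithinAt
  have hprod : ∀ (p : Polynomial ℝ) (ψ : ℝ → ℂ), ContinuousOn ψ (Set.Ioi 0) →
      (∀ s ∈ Set.Ioi (0 : ℝ), ‖ψ s‖ ≤ C) → MeasureTheory.IntegrableOn
        (fun s : ℝ => ((p.eval s * Real.exp (-(1 / 2 * s)) : ℝ) : ℂ) * ψ s) (Set.Ioi 0) := by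
    intro p ψ hψ hψb
    refine MeasureTheory.Integrable.mul_bdd (c := C) (integrableOn_polynomial_mul_exp_ofReal p)
      (hψ.aestronglyMeasurable measurableSet_Ioi) ?_
    filter_upwards [MeasureTheory.ae_restrict_mem measurableSet_Ioi] with s hs
    exact hψb s hs
  have hint : MeasureTheory.IntegrableOn (fun s : ℝ =>
      (-(s * φ₂ s) - φ₁ s + (s / 4 - 1 / 2 - n) * φ s) * (laguerreFunOne n s : ℂ))
      (Set.Ioi 0) := by
    have i2 := hprod (-Polynomial.X * laguerrePolynomial n) φ₂ hc hb2
    have i1 := hprod (-laguerrePolynomial n) φ₁ hm1 hb1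
    have i0 := hprod ((Polynomial.C (1 / 4) * Polynomial.X - Polynomial.C (1 / 2 + n : ℝ)) *
      laguerrePolynomial n) φ hm0 hb
    refine ((i2.add i1).add i0).congr (Filter.Eventually.of_forall fun s => ?_)
    simp [laguerreFunOne_eq]
    ring
  rw [MeasureTheory.integral_Ioi_of_hasDerivAt_of_tendsto hcont hder hint hinf, hG0, sub_zero]

theorem insertNth_mem_orthant {k : ℕ} (j : Fin (k + 1)) {s : ℝ} (hs : 0 < s) {y : Fin k → ℝ}
    (hy : y ∈ orthant k) : (j.insertNth s y : Fin (k + 1) → ℝ) ∈ orthant (k + 1) := by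
  intro i
  refine Fin.succAboveCases j ?_ (fun i => ?_) i
  · simpa using hs
  · simpa using hy i

theorem hasDerivAt_insertNth {k : ℕ} (j : Fin (k + 1)) (s : ℝ) (y : Fin k → ℝ) :
    HasDerivAt (fun s => (j.insertNth s y : Fin (k + 1) → ℝ)) (Pi.single j 1) s := by
  rw [hasDerivAt_pi]
  intro i
  refine Fin.succAboveCases j ?_ (fun i => ?_) i
  · simpa using hasDerivAt_id' s
  · simpa [Fin.succAbove_ne] using hasDerivAt_const s (y i)

theorem hasDerivAt_comp_insertNth {k : ℕ} {f : (Fin (k + 1) → ℝ) → ℂ}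
    (hf : ContDiffOn ℝ ∞ f (orthant (k + 1))) (j : Fin (k + 1)) {s : ℝ} (hs : 0 < s)
    {y : Fin k → ℝ} (hy : y ∈ orthant k) :
    HasDerivAt (fun s => f (j.insertNth s y)) (pderiv j f (j.insertNth s y)) s :=
  (hf.differentiableAt_orthant (insertNth_mem_orthant j hs hy)).hasFDerivAt.comp_hasDerivAt s
    (hasDerivAt_insertNth j s y)

/-- An integrable function whose integrals along all lines in direction `j` vanish. -/
theorem integral_orthant_eq_zero {k : ℕ} (j : Fin (k + 1)) {h : (Fin (k + 1) → ℝ) → ℂ}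
    (hh : MeasureTheory.IntegrableOn h (orthant (k + 1)))
    (h0 : ∀ y ∈ orthant k, ∫ s in Set.Ioi (0 : ℝ), h (j.insertNth s y) = 0) :
    ∫ x in orthant (k + 1), h x = 0 := by
  have mp := (MeasureTheory.measurePreserving_piFinSuccAbove
    (fun _ : Fin (k + 1) => MeasureTheory.volume.restrict (Set.Ioi (0 : ℝ))) j).symm
  rw [MeasureTheory.IntegrableOn, volume_restrict_orthant] at hh
  rw [volume_restrict_orthant, ← mp.integral_comp']
  have hi := (mp.integrable_comp_emb (MeasurableEquiv.measurableEmbedding _)).mpr hh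
  rw [← volume_restrict_orthant] at hi ⊢
  refine (MeasureTheory.integral_prod_symm _ hi).trans ?_
  rw [MeasureTheory.integral_eq_zero_of_ae]
  filter_upwards [MeasureTheory.ae_restrict_mem (measurableSet_orthant k)] with y hy
  exact h0 y hy

/-- Symmetry of 1 + E_j, tested along lines: with the other coordinates fixed, the difference of the
two integrands is a constant multiple of the expression integrated to zero by
`integral_laguerreOp_mul_laguerreFunOne`, and Fubini concludes. -/
theorem laguerreCoeff_oneAddLaguerreOp {d : ℕ} {f : (Fin d → ℝ) → ℂ}
    (hf : IsSchwartzOnOrthant f) (j : Fin d) (n : Fin d → ℕ) :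
    laguerreCoeff (oneAddLaguerreOp j f) n = ((n j : ℂ) + 1) * laguerreCoeff f n := by
  cases d with
  | zero => exact j.elim0
  | succ k =>
    have hi1 := (integral_norm_mul_laguerreFun_le (hf.oneAddLaguerreOp j).integrableOn n).1
    have hi2 := ((integral_norm_mul_laguerreFun_le hf.integrableOn n).1).const_mul ((n j : ℂ) + 1)
    rw [laguerreCoeff, laguerreCoeff, ← sub_eq_zero, ← MeasureTheory.integral_const_mul,
      ← MeasureTheory.integral_sub hi1 hi2]
    refine integral_orthant_eq_zero j (hi1.sub hi2) fun y hy => ?_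
    have hf1 := hf.pderiv j
    have hf2 := hf1.pderiv j
    obtain ⟨C0, hC0⟩ := hf.exists_bound
    obtain ⟨C1, hC1⟩ := hf1.exists_bound
    obtain ⟨C2, hC2⟩ := hf2.exists_bound
    have hmem : ∀ s ∈ Set.Ioi (0 : ℝ), (j.insertNth s y : Fin (k + 1) → ℝ) ∈ orthant (k + 1) :=
      fun s hs => insertNth_mem_orthant j hs hy
    have key := integral_laguerreOp_mul_laguerreFunOne (C := max C0 (max C1 C2))
      (fun s hs => hasDerivAt_comp_insertNth hf.smooth j hs hy)
      (fun s hs => hasDerivAt_comp_insertNth hf1.smooth j hs hy)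
      (hf2.smooth.continuousOn.comp
        (fun s _ => (hasDerivAt_insertNth j s y).continuousAt.continuousWithinAt) hmem)
      (fun s hs => (hC0 _ (hmem s hs)).trans (le_max_left _ _))
      (fun s hs => (hC1 _ (hmem s hs)).trans ((le_max_left _ _).trans (le_max_right _ _)))
      (fun s hs => (hC2 _ (hmem s hs)).trans ((le_max_right _ _).trans (le_max_right _ _))) (n j)
    rw [← mul_zero ((∏ i, laguerreFunOne (n (j.succAbove i)) (y i) : ℝ) : ℂ), ← key,
      ← MeasureTheory.integral_const_mul]
    refine MeasureTheory.integral_congr_ae (Filter.Eventually.of_forall fun s => ?_)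
    simp only [oneAddLaguerreOp, coordMul, laguerreFun_eq_prod]
    rw [Fin.prod_univ_succAbove _ j]
    simp only [Fin.insertNth_apply_same, Fin.insertNth_apply_succAbove]
    push_cast
    ring

/-- Smoothness is traded for decay by applying (1 + E_j)^p for each j in s. The shift by 1 keeps
every eigenvalue nonzero. -/
theorem exists_laguerreCoeff_eq_mul {d : ℕ} {f : (Fin d → ℝ) → ℂ}
    (hf : IsSchwartzOnOrthant f) (p : ℕ) (s : Finset (Fin d)) :
    ∃ g : (Fin d → ℝ) → ℂ, IsSchwartzOnOrthant g ∧ ∀ n,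
      laguerreCoeff g n = (∏ j ∈ s, ((n j : ℂ) + 1) ^ p) * laguerreCoeff f n := by
  induction s using Finset.induction_on with
  | empty => exact ⟨f, hf, fun n => by simp⟩
  | insert j s hj ih =>
    obtain ⟨g, hg, he⟩ := ih
    have hit : ∀ q : ℕ, IsSchwartzOnOrthant ((oneAddLaguerreOp j)^[q] g) ∧ ∀ n,
        laguerreCoeff ((oneAddLaguerreOp j)^[q] g) n = ((n j : ℂ) + 1) ^ q * laguerreCoeff g n := by
      intro q
      induction q with
      | zero => exact ⟨hg, fun n => by simp⟩
      | succ q ihq =>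
        rw [Function.iterate_succ_apply']
        refine ⟨ihq.1.oneAddLaguerreOp j, fun n => ?_⟩
        rw [laguerreCoeff_oneAddLaguerreOp ihq.1, ihq.2]
        ring
    refine ⟨_, (hit p).1, fun n => ?_⟩
    rw [(hit p).2, he, Finset.prod_insert hj, mul_assoc]

/-- The Laguerre coefficients of a Schwartz function are rapidly decreasing. -/
theorem summable_laguerreCoeff {d : ℕ} {f : (Fin d → ℝ) → ℂ} (hf : IsSchwartzOnOrthant f) :
    Summable fun n : Fin d → ℕ => ‖laguerreCoeff f n‖ * ∏ j, ((n j : ℝ) + 1) := by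
  -- Of the four powers, one pays for the growth of l_n, one for the weight in the claim, and two
  -- give summability.
  obtain ⟨g, hg, he⟩ := exists_laguerreCoeff_eq_mul hf 4 Finset.univ
  refine Summable.of_nonneg_of_le (fun n => by positivity) (fun n => ?_)
    ((summable_prod_inv_sq d).mul_left ((∫ x in orthant d, ‖g x‖) * 3 ^ d))
  have hb : ‖laguerreCoeff g n‖ ≤ (∫ x in orthant d, ‖g x‖) * (3 ^ d * ∏ j, ((n j : ℝ) + 1)) :=
    (MeasureTheory.norm_integral_le_integral_norm _).trans
      (integral_norm_mul_laguerreFun_le hg.integrableOn n).2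
  have hW : ‖∏ j, ((n j : ℂ) + 1) ^ 4‖ = (∏ j, ((n j : ℝ) + 1)) ^ 4 := by
    rw [norm_prod, ← Finset.prod_pow]
    refine Finset.prod_congr rfl fun j _ => ?_
    rw [norm_pow, ← Nat.cast_succ, Complex.norm_natCast, Nat.cast_succ]
  rw [he, norm_mul, hW] at hb
  have hinv : ∏ j, (((n j : ℝ) + 1) ^ 2)⁻¹ = ((∏ j, ((n j : ℝ) + 1)) ^ 2)⁻¹ := by
    rw [Finset.prod_inv_distrib, Finset.prod_pow]
  rw [hinv]
  have hpos : 0 < ∏ j, ((n j : ℝ) + 1) := Finset.prod_pos fun j _ => by positivity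
  set W := ∏ j, ((n j : ℝ) + 1)
  rw [← div_eq_mul_inv, le_div_iff₀ (by positivity)]
  refine le_of_mul_le_mul_right ?_ hpos
  calc _ = W ^ 4 * ‖laguerreCoeff f n‖ := by ring
    _ ≤ _ := hb
    _ = _ := by ring

end

/-! ### The propagator at imaginary time. -/

theorem lemma3p2 {d : ℕ} (t : ℝ) (ht : ∀ k : ℤ, t ≠ 2 * Real.pi * k)
    (f : (Fin d → ℝ) → ℂ) (hf : IsSchwartzOnOrthant f) :
    -- the series defining `e^{itE} f` converges absolutely at every point of the orthant
    (∀ x ∈ orthant d, Summable fun n : Fin d → ℕ =>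
      ‖propagatorCoeff (t * Complex.I) f n * (laguerreFun n x : ℂ)‖) ∧
    -- its sum is an `L²` function with Laguerre coefficients `e^{it|n|} a_n(f)`
    MeasureTheory.MemLp (laguerrePropagator (t * Complex.I) f) 2
      (MeasureTheory.volume.restrict (orthant d)) ∧
    (∀ n : Fin d → ℕ, laguerreCoeff (laguerrePropagator (t * Complex.I) f) n =
      propagatorCoeff (t * Complex.I) f n) ∧
    -- `e^{itE}` is the integral operator with kernel `K_{it}` (absolutely convergent integral)
    (∀ x ∈ orthant d,
      MeasureTheory.IntegrableOn (fun y => f y * propagatorKernel (t * Complex.I) x y)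
        (orthant d) ∧
      laguerrePropagator (t * Complex.I) f x =
        ∫ y in orthant d, f y * propagatorKernel (t * Complex.I) x y) ∧
    -- `e^{itE} f` is the fractional power of the Hankel-Clifford transform of `f`
    (∀ x ∈ orthant d, laguerrePropagator (t * Complex.I) f x =
      fracHankelClifford (Complex.exp (t * Complex.I)) f x) := by
  have hi := hf.integrableOn
  have hc := summable_laguerreCoeff hf
  set w : ℂ := Complex.exp (t * Complex.I) with hw
  have hwn : ‖w‖ = 1 := Complex.norm_exp_ofReal_mul_I t
  have hw1 : w ≠ 1 := by
    intro h
    obtain ⟨k, hk⟩ := Complex.exp_eq_one_iff.mp h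
    refine ht k ?_
    have hI : (t : ℂ) * Complex.I = ((2 * Real.pi * k : ℝ) : ℂ) * Complex.I := by
      rw [hk]
      push_cast
      ring
    exact_mod_cast mul_right_cancel₀ Complex.I_ne_zero hI
  have hcoeff : ∀ n : Fin d → ℕ, propagatorCoeff (t * Complex.I) f n =
      w ^ (∑ j, n j) * laguerreCoeff f n := fun n => by
    rw [propagatorCoeff, mul_comm (t * Complex.I), Complex.exp_nat_mul]
  have hcn : ∀ n : Fin d → ℕ, ‖propagatorCoeff (t * Complex.I) f n‖ = ‖laguerreCoeff f n‖ :=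
    fun n => by rw [hcoeff, norm_mul, norm_pow, hwn, one_pow, one_mul]
  have hpc : Summable fun n : Fin d → ℕ =>
      ‖propagatorCoeff (t * Complex.I) f n‖ * ∏ j, ((n j : ℝ) + 1) := by
    simpa only [hcn] using hc
  have hpc1 : Summable fun n : Fin d → ℕ => ‖propagatorCoeff (t * Complex.I) f n‖ := by
    refine hpc.of_nonneg_of_le (fun _ => norm_nonneg _) fun n => ?_
    refine le_mul_of_one_le_right (norm_nonneg _) (Finset.one_le_prod fun j _ => ?_)
    linarith [(Nat.cast_nonneg (n j) : (0 : ℝ) ≤ n j)]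
  have hker : ∀ x ∈ orthant d, laguerrePropagator (t * Complex.I) f x =
      ∫ y in orthant d, f y * propagatorKernel (t * Complex.I) x y := fun x hx => by
    simp_rw [laguerrePropagator, hcoeff, propagatorKernel_eq]
    exact tsum_pow_mul_laguerreCoeff hi hc hwn hw1 hx
  refine ⟨fun x hx => summable_norm_mul_laguerreFun hpc hx, memLp_two_tsum_laguerreFun hpc1,
    fun n => laguerreCoeff_tsum hpc1 n, fun x hx => ⟨?_, hker x hx⟩, fun x hx => ?_⟩
  · simp_rw [propagatorKernel_eq]
    exact integrableOn_mul_prod_kernelOne hi hwn.le hw1 hx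
  -- The two integrals differ only in whether (1 - w)^{-d} stands inside or outside.
  · rw [hker x hx, fracHankelClifford, ← MeasureTheory.integral_const_mul]
    refine MeasureTheory.integral_congr_ae (Filter.Eventually.of_forall fun y => ?_)
    exact mul_left_comm _ _ _
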